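/- **Setup.** Let $f:\mathbb R^{n_x}\times\mathbb R^{n_p}\to\mathbb R^{n_x}$, let $P\subset\mathbb R^{n_p}$ be convex and compact, and let $Q\subset P$ be the set of $p\in P$ for which $f(z,p)=0$ has a solution $z\in\mathbb R^{n_x}$. Assume that $Q\neq\emptyset$ and that there are an interval $X=[x^L,x^U]\subset\mathbb R^{n_x}$ and a function $x:Q\to X$ with $f(x(p),p)=0$ for all $p\in Q$. Let $f^{cv},f^{cc}:X\times P\to\mathbb R^{n_x}$ be a convex and a concave relaxation of $f$ on $X\times P$ (componentwise $f^{cv}\le f\le f^{cc}$, with $f^{cv}$ convex and $f^{cc}$ concave on $X\times P$), and for $i\in\{1,\dots,n_x\}$ and $p\in P$ put $$x_i^{cv}(p):=\inf\{\xi_i:\ \xi\in X,\ f^{cv}(\xi,p)\le 0\le f^{cc}(\xi,p)\}\in\mathbb R\cup\{+\infty\},\qquad \inf\emptyset=+\infty .$$ Up to the order of the components let $f=(\tilde f,h)$ with $h$ affine in $(\xi,p)$ and $h^{cv}=h^{cc}=h$ on $X\times P$. For each component $a$ of $\tilde f$ suppose that there are finitely many continuously differentiable convex functions $\tilde f_a^{cv,j}$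 and concave functions $\tilde f_a^{cc,j}$ on $\mathbb R^{n_x}\times\mathbb R^{n_p}$ with $\tilde f_a^{cv}=\max_j\tilde f_a^{cv,j}$ and $\tilde f_a^{cc}=\min_j\tilde f_a^{cc,j}$ on $X\times P$. Let $g$ be the vector of all the functions $\tilde f_a^{cv,j}$, $-\tilde f_a^{cc,j}$, $x^L_m-\xi_m$ and $\xi_m-x^U_m$. Let $\hat p\in\mathrm{int}(Q)$. Suppose that the (constant) gradients $\nabla_\xi h_b$ are linearly independent, and that $\hat p$ has a neighborhood $N\subset Q$ such that for each $p\in N$ there is $\xi\in X$ with $h(\xi,p)=0$ and $g(\xi,p)<0$. **Definitions.** $\phi'(u;d)$ denotes the one-sided directional derivative. The homogenization sequence of $\phi$ at $\hat p$ in the directions $M=[m_{(1)}\cdots m_{(r)}]\in\mathbb R^{n_p\times r}$ is $\phi^{(0)}(d)=\phi'(\hat p;d)$, $\phi^{(j)}(d)=[\phi^{(j-1)}]'(m_{(j)};d)$ for $j=1,\dots,r$. A function $\phi$ on an open set is L-smooth at a point $\hat p$ of it if it is locally Lipschitz on that open set, is directionally differentiable at $\hat p$, and its homogenization sequence exists with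 finite values for all $r$ and $M$. The LD-derivative is the row vector $\phi'(\hat p;M)=[\phi^{(0)}(m_{(1)})\ \cdots\ \phi^{(r-1)}(m_{(r)})]$. If the columns of $M$ span $\mathbb R^{n_p}$, the L-derivative of $\phi$ at $\hat p$ in the directions $M$ is the Jacobian (row vector) of $\phi^{(r)}$ at $0$. **Theorem.** Let $i\in\{1,\dots,n_x\}$. For every $p\in Q$ the value $x_i^{cv}(p)$ is finite and is the minimum of $\xi_i$ over all $\xi\in\mathbb R^{n_x}$ with $h(\xi,p)=0$, $g(\xi,p)\le 0$. The function $x_i^{cv}$, as a real-valued function on $\mathrm{int}(Q)$, is L-smooth at $\hat p$. Let $\hat\xi$ be any optimal solution of this minimization problem at $p=\hat p$. Let $A$ have the rows $[\nabla_\xi g_q(\hat\xi,\hat p)]^T$ for the indices $q$ with $g_q(\hat\xi,\hat p)=0$, let $B$ have the rows $[\nabla_\xi h_b(\hat\xi,\hat p)]^T$, and let $G=\begin{bmatrix}G^A\\G^B\end{bmatrix}$ have the corresponding rows $-[\nabla_p g_q(\hat\xi,\hat p)]^T$ and $-[\nabla_p h_b(\hat\xi,\hat p)]^T$. Let $r\ge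 0$ and $M=[m_{(1)}\cdots m_{(r)}]\in\mathbb R^{n_p\times r}$, and let $\phi^{(0)},\dots,\phi^{(r)}$ be the homogenization sequence of $x_i^{cv}$ at $\hat p$ in the directions $M$. Then: 1. For all $j\in\{0,\dots,r\}$ and $d\in\mathbb R^{n_p}$, the maximum in the following linear program is attained and $$\phi^{(j)}(d)=\max_{\lambda=(\lambda^A,\lambda^B)}\ [Gd]^T\lambda\quad\text{s.t.}\quad A^T\lambda^A+B^T\lambda^B=e^{(i)},\ \ \lambda^A\le 0,\ \ -[Gm_{(k)}]^T\lambda\le-\phi^{(k-1)}(m_{(k)})\ \ (k=1,\dots,j).$$ 2. For $j\in\{0,\dots,r-1\}$ let $D^{(j)}$ be the optimal solution set of the linear program for $\phi^{(j)}(m_{(j+1)})$. Then for each $j\in\{1,\dots,r-1\}$, $D^{(j)}=\arg\max_{\lambda\in D^{(j-1)}}[Gm_{(j+1)}]^T\lambda\subset D^{(j-1)}$. 3. If $r\ge1$, then $[x_i^{cv}]'(\hat p;M)=\lambda^TGM$ for every $\lambda\in D^{(r-1)}$. 4. If the columns of $M$ span $\mathbb R^{n_p}$, then the L-derivative $J$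 of $x_i^{cv}$ at $\hat p$ in the directions $M$ exists, is the unique solution of the linear system $JM=[x_i^{cv}]'(\hat p;M)$, and equals $\lambda^TG$ for every $\lambda\in D^{(r-1)}$ (if $r\ge1$); and $J^T$ is a subgradient of $x_i^{cv}$ at $\hat p$: $x_i^{cv}(p)\ge x_i^{cv}(\hat p)+J(p-\hat p)$ for all $p\in P$. -/

import Mathlib

open Set Filter Topology Matrix

/-! ### Directional derivatives and lexicographic differentiation (scalar-valued functions) -/

section Lexicographic

variable {n r : ℕ}

/-- `v` is the (finite) one-sided directional derivative of `f` at `x` in the direction `d`. -/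
def HasDirDeriv (f : (Fin n → ℝ) → ℝ) (x d : Fin n → ℝ) (v : ℝ) : Prop :=
  Tendsto (fun α : ℝ => (f (x + α • d) - f x) / α) (𝓝[>] 0) (𝓝 v)

/-- `φ 0, …, φ r` is the homogenization sequence of `f` at `x` in the directions given by the
columns of `M`: `φ 0 d = f'(x; d)`, and `φ j d` is the directional derivative of `φ (j - 1)` at the
`j`-th column of `M` in the direction `d`. (Columns are numbered from `0` in the code.) All the
directional derivatives are required to exist, so such a `φ` exists exactly when the sequence is
well defined, and it is then unique. -/
def IsHomogSeq (f : (Fin n → ℝ) → ℝ) (x : Fin n → ℝ) (M : Matrix (Fin n) (Fin r) ℝ)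
    (φ : Fin (r + 1) → (Fin n → ℝ) → ℝ) : Prop :=
  (∀ d, HasDirDeriv f x d (φ 0 d)) ∧
  ∀ (k : Fin r) (d), HasDirDeriv (φ k.castSucc) (M.col k) d (φ k.succ d)

/-- Lexicographic smoothness at `x` of a function `f` on the open set `U`. -/
def LSmoothAt (U : Set (Fin n → ℝ)) (f : (Fin n → ℝ) → ℝ) (x : Fin n → ℝ) : Prop :=
  IsOpen U ∧ x ∈ U ∧ LocallyLipschitzOn U f ∧ (∀ d, ∃ v, HasDirDeriv f x d v) ∧
  ∀ (r : ℕ) (M : Matrix (Fin n) (Fin r) ℝ), ∃ φ, IsHomogSeq f x M φ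

/-- `L` is the lexicographic directional derivative (a row vector) of `f` at `x` in the directions
`M`. -/
def IsLDDerivative (f : (Fin n → ℝ) → ℝ) (x : Fin n → ℝ) (M : Matrix (Fin n) (Fin r) ℝ)
    (L : Fin r → ℝ) : Prop :=
  ∃ φ, IsHomogSeq f x M φ ∧ ∀ k : Fin r, L k = φ k.castSucc (M.col k)

/-- The row vector `J` is the lexicographic derivative of `f` at `x` in the directions `M`: the
Jacobian at `0` of the last function of the homogenization sequence. The columns of `M` have to
span the space; for `r = n` this says that `M` is nonsingular. -/
def IsLDerivative (f : (Fin n → ℝ) → ℝ) (x : Fin n → ℝ) (M : Matrix (Fin n) (Fin r) ℝ)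
    (J : Fin n → ℝ) : Prop :=
  Submodule.span ℝ (Set.range M.col) = ⊤ ∧
  ∃ φ, IsHomogSeq f x M φ ∧
    HasFDerivAt (φ (Fin.last r))
      (∑ m, J m • (ContinuousLinearMap.proj m : (Fin n → ℝ) →L[ℝ] ℝ)) 0

/-- `s` is a subgradient at `x` of the extended-real-valued function `f` on `P`, where `f` is finite
at `x`. -/
def IsSubgradient (P : Set (Fin n → ℝ)) (f : (Fin n → ℝ) → EReal) (x s : Fin n → ℝ) : Prop :=
  x ∈ P ∧ f x ≠ ⊤ ∧ f x ≠ ⊥ ∧ ∀ p ∈ P, f x + ((s ⬝ᵥ (p - x) : ℝ) : EReal) ≤ f p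

end Lexicographic

/-- The set of maximizers of `c` over `S`. -/
def argmaxOn {E : Type*} (S : Set E) (c : E → ℝ) : Set E :=
  {v | v ∈ S ∧ ∀ u ∈ S, c u ≤ c v}

/-! ### The dual linear programs with accumulated constraints -/

section DualLP

variable {κ β : Type*} [Fintype κ] [Fintype β] {nx np r : ℕ}

/-- The feasible set of the `j`-th linear program: `Aᵀ v^A + Bᵀ v^B = e⁽ⁱ⁾`, `v^A ≤ 0`, and
`-[G m_k]ᵀ v ≤ -φ_{k-1}(m_k)` for the first `j` columns `m_k` of `M`. -/
def dualFeasible (A : Matrix κ (Fin nx) ℝ) (B : Matrix β (Fin nx) ℝ)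
    (G : Matrix (κ ⊕ β) (Fin np) ℝ) (i : Fin nx) (M : Matrix (Fin np) (Fin r) ℝ)
    (φ : Fin (r + 1) → (Fin np → ℝ) → ℝ) (j : Fin (r + 1)) : Set (κ ⊕ β → ℝ) :=
  {v | Aᵀ *ᵥ (fun a => v (Sum.inl a)) + Bᵀ *ᵥ (fun b => v (Sum.inr b)) = Pi.single i 1 ∧
    (∀ a, v (Sum.inl a) ≤ 0) ∧
    ∀ k : Fin r, k.castSucc < j → -((G *ᵥ M.col k) ⬝ᵥ v) ≤ -(φ k.castSucc (M.col k))}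

/-- The optimal solution set `D⁽ʲ⁾` of the `j`-th linear program with the objective `[G d]ᵀ v`,
where `d` is the column of `M` with (zero-based) number `j`. -/
def dualOptSet (A : Matrix κ (Fin nx) ℝ) (B : Matrix β (Fin nx) ℝ)
    (G : Matrix (κ ⊕ β) (Fin np) ℝ) (i : Fin nx) (M : Matrix (Fin np) (Fin r) ℝ)
    (φ : Fin (r + 1) → (Fin np → ℝ) → ℝ) (j : Fin r) : Set (κ ⊕ β → ℝ) :=
  argmaxOn (dualFeasible A B G i M φ j.castSucc) (fun v => (G *ᵥ M.col j) ⬝ᵥ v)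

end DualLP

/-! ### Implicit functions and their relaxations -/

/-- `φcv` is a convex relaxation of `φ` on `S`. -/
def IsConvexRelaxation {E : Type*} [AddCommGroup E] [Module ℝ E] (S : Set E) (φ φcv : E → ℝ) :
    Prop :=
  (∀ z ∈ S, φcv z ≤ φ z) ∧ ConvexOn ℝ S φcv

/-- `φcc` is a concave relaxation of `φ` on `S`. -/
def IsConcaveRelaxation {E : Type*} [AddCommGroup E] [Module ℝ E] (S : Set E) (φ φcc : E → ℝ) :
    Prop :=
  (∀ z ∈ S, φ z ≤ φcc z) ∧ ConcaveOn ℝ S φcc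

/-- The partial gradient of `g` with respect to its first argument. -/
noncomputable def gradX {nx np : ℕ} (g : (Fin nx → ℝ) × (Fin np → ℝ) → ℝ)
    (ξ : Fin nx → ℝ) (p : Fin np → ℝ) : Fin nx → ℝ :=
  fun m => fderiv ℝ (fun ξ' => g (ξ', p)) ξ (Pi.single m 1)

/-- The partial gradient of `g` with respect to its second argument. -/
noncomputable def gradP {nx np : ℕ} (g : (Fin nx → ℝ) × (Fin np → ℝ) → ℝ)
    (ξ : Fin nx → ℝ) (p : Fin np → ℝ) : Fin np → ℝ :=
  fun m => fderiv ℝ (fun p' => g (ξ, p')) p (Pi.single m 1)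

/-- The data of an implicit function with relaxations of the residual function; the assumptions on
the data are the predicates below. -/
structure ImplicitSystem (nx np nf nh : ℕ) where
  /-- the residual function -/
  f : (Fin nx → ℝ) × (Fin np → ℝ) → Fin nx → ℝ
  /-- the parameter set -/
  P : Set (Fin np → ℝ)
  /-- lower corner of the box `X` -/
  xL : Fin nx → ℝ
  /-- upper corner of the box `X` -/
  xU : Fin nx → ℝ
  /-- the implicit function; only its values on `Q` matter -/
  x : (Fin np → ℝ) → Fin nx → ℝ
  /-- convex relaxations of the components of `f` -/
  fcv : Fin nx → (Fin nx → ℝ) × (Fin np → ℝ) → ℝ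
  /-- concave relaxations of the components of `f` -/
  fcc : Fin nx → (Fin nx → ℝ) × (Fin np → ℝ) → ℝ
  /-- the arrangement of the components of `f` as `(f̃, h)` -/
  e : Fin nf ⊕ Fin nh ≃ Fin nx
  /-- numbers of pieces of the convex relaxations of `f̃` -/
  k : Fin nf → ℕ
  /-- numbers of pieces of the concave relaxations of `f̃` -/
  l : Fin nf → ℕ
  /-- pieces of the convex relaxations of `f̃` -/
  cvPiece : (a : Fin nf) → Fin (k a) → (Fin nx → ℝ) × (Fin np → ℝ) → ℝ
  /-- pieces of the concave relaxations of `f̃` -/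
  ccPiece : (a : Fin nf) → Fin (l a) → (Fin nx → ℝ) × (Fin np → ℝ) → ℝ

namespace ImplicitSystem

variable {nx np nf nh : ℕ} (S : ImplicitSystem nx np nf nh)

/-- The box `X = [xL, xU]`. -/
def X : Set (Fin nx → ℝ) := Set.Icc S.xL S.xU

/-- The set of parameters in `P` for which the residual equation is solvable. -/
def Q : Set (Fin np → ℝ) := {p | p ∈ S.P ∧ ∃ z, S.f (z, p) = 0}

/-- The (affine) components `h` of the residual function. -/
def h (b : Fin nh) : (Fin nx → ℝ) × (Fin np → ℝ) → ℝ := fun z => S.f z (S.e (Sum.inr b))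

/-- The standing setup: `x` is an implicit function on `Q` with values in the box `X`. -/
structure IsImplicitSetup : Prop where
  convex_P : Convex ℝ S.P
  compact_P : IsCompact S.P
  box : S.xL ≤ S.xU
  nonempty_Q : S.Q.Nonempty
  solves : ∀ p ∈ S.Q, S.f (S.x p, p) = 0
  mem_box : ∀ p ∈ S.Q, S.x p ∈ S.X

/-- `fcv` and `fcc` are relaxations of the residual function on `X × P`; the components `h` are
affine and serve as their own relaxations, and the relaxations of the other components are maxima
(minima) of finitely many continuously differentiable convex (concave) functions. -/
structure IsPiecewiseDiffRelaxed : Prop where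
  relax_cv : ∀ c, IsConvexRelaxation (S.X ×ˢ S.P) (fun z => S.f z c) (S.fcv c)
  relax_cc : ∀ c, IsConcaveRelaxation (S.X ×ˢ S.P) (fun z => S.f z c) (S.fcc c)
  affine_h : ∀ b, ∃ L : ((Fin nx → ℝ) × (Fin np → ℝ)) →ᵃ[ℝ] ℝ, ∀ z, S.h b z = L z
  cv_h : ∀ b, ∀ z ∈ S.X ×ˢ S.P, S.fcv (S.e (Sum.inr b)) z = S.h b z
  cc_h : ∀ b, ∀ z ∈ S.X ×ˢ S.P, S.fcc (S.e (Sum.inr b)) z = S.h b z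
  contDiff_cv : ∀ a j, ContDiff ℝ 1 (S.cvPiece a j)
  contDiff_cc : ∀ a j, ContDiff ℝ 1 (S.ccPiece a j)
  convex_cv : ∀ a j, ConvexOn ℝ Set.univ (S.cvPiece a j)
  concave_cc : ∀ a j, ConcaveOn ℝ Set.univ (S.ccPiece a j)
  cv_eq_max : ∀ a, ∀ z ∈ S.X ×ˢ S.P,
    IsGreatest (Set.range fun j => S.cvPiece a j z) (S.fcv (S.e (Sum.inl a)) z)
  cc_eq_min : ∀ a, ∀ z ∈ S.X ×ˢ S.P,
    IsLeast (Set.range fun j => S.ccPiece a j z) (S.fcc (S.e (Sum.inl a)) z)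

/-- The convex relaxation `x_i^cv` of the `i`-th component of the implicit function; the infimum
is `+∞` if the constraints are infeasible. -/
noncomputable def xcv (i : Fin nx) (p : Fin np → ℝ) : EReal :=
  ⨅ ξ ∈ {ξ : Fin nx → ℝ | ξ ∈ S.X ∧ ∀ c, S.fcv c (ξ, p) ≤ 0 ∧ 0 ≤ S.fcc c (ξ, p)},
    ((ξ i : ℝ) : EReal)

/-- `x_i^cv` as a real-valued function (it is finite on `Q`). -/
noncomputable def xcvReal (i : Fin nx) (p : Fin np → ℝ) : ℝ := (S.xcv i p).toReal

/-- The index set of the inequality constraints: pieces of the convex relaxations, pieces of the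
concave relaxations, lower and upper bounds of the box. -/
abbrev IneqIdx : Type :=
  ((a : Fin nf) × Fin (S.k a)) ⊕ ((a : Fin nf) × Fin (S.l a)) ⊕ Fin nx ⊕ Fin nx

/-- The inequality constraint functions; the constraint `ξ ∈ X` is incorporated. -/
def g : S.IneqIdx → (Fin nx → ℝ) × (Fin np → ℝ) → ℝ
  | Sum.inl ⟨a, j⟩, z => S.cvPiece a j z
  | Sum.inr (Sum.inl ⟨a, j⟩), z => -S.ccPiece a j z
  | Sum.inr (Sum.inr (Sum.inl m)), z => S.xL m - z.1 m
  | Sum.inr (Sum.inr (Sum.inr m)), z => z.1 m - S.xU m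

/-- The feasible region of the reformulated problem. -/
def Ω (p : Fin np → ℝ) : Set (Fin nx → ℝ) :=
  {ξ | (∀ b, S.h b (ξ, p) = 0) ∧ ∀ q, S.g q (ξ, p) ≤ 0}

/-- `ξ` is an optimal solution of: minimize `ξ_i` over `Ω(p)`. -/
def IsOptimal (i : Fin nx) (p : Fin np → ℝ) (ξ : Fin nx → ℝ) : Prop :=
  ξ ∈ S.Ω p ∧ ∀ η ∈ S.Ω p, ξ i ≤ η i

/-- The strong Slater condition around a point `phat` of the interior of `Q`, together with linear
independence of the (constant) gradients of `h` with respect to `ξ`. -/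
structure IsSlater (phat : Fin np → ℝ) : Prop where
  mem_interior : phat ∈ interior S.Q
  linearIndependent : ∀ ξ p, LinearIndependent ℝ fun b => gradX (S.h b) ξ p
  slater : ∃ N ∈ 𝓝 phat, N ⊆ S.Q ∧
    ∀ p ∈ N, ∃ ξ ∈ S.X, (∀ b, S.h b (ξ, p) = 0) ∧ ∀ q, S.g q (ξ, p) < 0

/-- The index set of the inequality constraints that are active at `(ξ, p)`. -/
abbrev ActiveIdx (ξ : Fin nx → ℝ) (p : Fin np → ℝ) : Type :=
  {q : S.IneqIdx // S.g q (ξ, p) = 0}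

noncomputable instance (ξ : Fin nx → ℝ) (p : Fin np → ℝ) : Fintype (S.ActiveIdx ξ p) :=
  Fintype.ofFinite _

/-- Rows: gradients with respect to `ξ` of the active inequality constraints. -/
noncomputable def matA (ξ : Fin nx → ℝ) (p : Fin np → ℝ) :
    Matrix (S.ActiveIdx ξ p) (Fin nx) ℝ :=
  Matrix.of fun q => gradX (S.g q.1) ξ p

/-- Rows: gradients with respect to `ξ` of the equality constraints. -/
noncomputable def matB (ξ : Fin nx → ℝ) (p : Fin np → ℝ) : Matrix (Fin nh) (Fin nx) ℝ :=
  Matrix.of fun b => gradX (S.h b) ξ p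

/-- The matrix `G`: the negative gradients with respect to `p` of the active inequality constraints
(block `G^A`) above those of the equality constraints (block `G^B`). -/
noncomputable def matG (ξ : Fin nx → ℝ) (p : Fin np → ℝ) :
    Matrix (S.ActiveIdx ξ p ⊕ Fin nh) (Fin np) ℝ :=
  Matrix.fromRows (Matrix.of fun q : S.ActiveIdx ξ p => -gradP (S.g q.1) ξ p)
    (Matrix.of fun b : Fin nh => -gradP (S.h b) ξ p)

/-- The feasible set of the `j`-th dual linear program built at `(ξ, p)`. -/
noncomputable def lpFeasible (ξ : Fin nx → ℝ) (p : Fin np → ℝ) (i : Fin nx) {r : ℕ}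
    (M : Matrix (Fin np) (Fin r) ℝ) (φ : Fin (r + 1) → (Fin np → ℝ) → ℝ) (j : Fin (r + 1)) :
    Set (S.ActiveIdx ξ p ⊕ Fin nh → ℝ) :=
  dualFeasible (S.matA ξ p) (S.matB ξ p) (S.matG ξ p) i M φ j

/-- The optimal solution set `D⁽ʲ⁾` of the `j`-th dual linear program built at `(ξ, p)`. -/
noncomputable def lpOptSet (ξ : Fin nx → ℝ) (p : Fin np → ℝ) (i : Fin nx) {r : ℕ}
    (M : Matrix (Fin np) (Fin r) ℝ) (φ : Fin (r + 1) → (Fin np → ℝ) → ℝ) (j : Fin r) :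
    Set (S.ActiveIdx ξ p ⊕ Fin nh → ℝ) :=
  dualOptSet (S.matA ξ p) (S.matB ξ p) (S.matG ξ p) i M φ j

end ImplicitSystem

/-! ### A theorem of the alternative for systems of linear inequalities -/

section Alternative

variable {κ β : Type*} [Fintype κ] [Fintype β] {n : ℕ}

/-! For fixed `p` the problem is a convex program, and its value is jointly governed by gradient
inequalities in `(ξ, p)`. Let `C` be the set of multipliers with `Aᵀ v^A + Bᵀ v^B = e⁽ⁱ⁾` and `v^A ≤
0` at an optimal point. The Slater point supplies a direction `σ` with `A σ < 0` and `B σ = 0`;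
together with the independent rows of `B` it makes `C` compact, and a theorem of the alternative
makes `C` nonempty.

The directional derivative of the value function along `d` is the maximum of `(G d)ᵀ v` over `C`
(`hasDirDeriv_xcvReal`). Weak duality gives the lower bound; the alternative gives, for every larger
number, a strictly feasible linearized direction that stays feasible for small steps.

From there the argument concerns only support functions of compact sets. By Danskin's theorem
(`hasDirDeriv_max_of_compact`), differentiating such a maximum at `m` replaces the set by its
maximizers for `m`. Iterating gives the homogenization sequence, and `mem_iteratedArgmax_iff`
identifies the successive argmax sets with the feasible sets of the linear programs. If the columns
of `M` span the space, all multipliers in the last set induce the same row `v ᵥ* G`, so the last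
function is linear; weak duality makes that row a subgradient. -/

theorem mulVec_surjective_of_linearIndependent_rows (B : Matrix β (Fin n) ℝ)
    (hB : LinearIndependent ℝ B) : Function.Surjective (fun x => B *ᵥ x) := by
  have h := LinearIndependent.rank_matrix (M := B) hB
  have : LinearMap.range B.mulVecLin = ⊤ := by
    apply Submodule.eq_top_of_finrank_eq
    rw [← Matrix.rank, h]
    simp
  exact LinearMap.range_eq_top.mp this

/-- Letting `s → 0` here and `s → ∞` in the next lemma turns a separation inequality into sign
conditions. -/
theorem nonneg_of_forall_pos_mul_lt {a K : ℝ} (h : ∀ s > 0, s * a < K) : 0 ≤ K := by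
  have h1 : Tendsto (fun s : ℝ => s * a) (𝓝[>] 0) (𝓝 (0 * a)) :=
    ((continuous_id.mul continuous_const).tendsto 0).mono_left nhdsWithin_le_nhds
  rw [zero_mul] at h1
  exact le_of_tendsto h1 (by filter_upwards [self_mem_nhdsWithin] with s hs using (h s hs).le)

theorem nonpos_of_forall_pos_mul_lt {a K : ℝ} (h : ∀ s > 0, s * a < K) : a ≤ 0 := by
  by_contra! ha
  have hK := nonneg_of_forall_pos_mul_lt h
  have := h ((K + 1) / a) (by positivity)
  rw [div_mul_cancel₀ _ ha.ne'] at this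
  linarith

theorem linearMap_pi_eq_dotProduct {ι : Type*} [Fintype ι] [DecidableEq ι] (f : (ι → ℝ) →ₗ[ℝ] ℝ)
    (x : ι → ℝ) : f x = (fun j => f (Pi.single j 1)) ⬝ᵥ x := by
  conv_lhs => rw [f.pi_apply_eq_sum_univ x]
  simp only [dotProduct, smul_eq_mul]
  refine Finset.sum_congr rfl fun j _ => ?_
  rw [mul_comm]
  congr 2
  ext k
  simp [Pi.single_apply, eq_comm]

/-- Multipliers separating a point from the values of a system of strict inequalities and
equations. -/
theorem exists_multipliers_of_not_exists (A : Matrix κ (Fin n) ℝ) (B : Matrix β (Fin n) ℝ)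
    (hB : LinearIndependent ℝ B) (i : Fin n) (a : κ → ℝ) (b : β → ℝ) (c : ℝ)
    (h : ¬ ∃ δ, (∀ q, (A *ᵥ δ) q < a q) ∧ B *ᵥ δ = b ∧ δ i < c) :
    ∃ (μ : κ → ℝ) (ν : β → ℝ) (τ : ℝ), ∀ (δ : Fin n → ℝ) (y : κ → ℝ) (w : ℝ),
      (∀ q, 0 < y q) → 0 < w →
        μ ⬝ᵥ (A *ᵥ δ) + ν ⬝ᵥ (B *ᵥ δ) + τ * δ i + μ ⬝ᵥ y + τ * w <
          μ ⬝ᵥ a + ν ⬝ᵥ b + τ * c := by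
  classical
  -- A system with slacks: `U` is the open convex set of `(y, δ, w)` with `A δ < y` and `δ i < w`,
  -- and `T` replaces `δ` by `B δ`. Surjectivity of `B` makes `T` open, so its image of `U` can be
  -- separated strictly from the point `(a, b, c)`.
  let T : ((κ → ℝ) × (Fin n → ℝ) × ℝ) →ₗ[ℝ] ((κ → ℝ) × (β → ℝ) × ℝ) :=
    LinearMap.prodMap LinearMap.id (LinearMap.prodMap B.mulVecLin LinearMap.id)
  have hT : ∀ y δ w, T (y, δ, w) = (y, B *ᵥ δ, w) := fun y δ w => rfl
  let U : Set ((κ → ℝ) × (Fin n → ℝ) × ℝ) :=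
    {z | (∀ q, (A *ᵥ z.2.1) q < z.1 q) ∧ z.2.1 i < z.2.2}
  have hTs : Function.Surjective T := by
    rintro ⟨y, z, w⟩
    obtain ⟨δ, hδ⟩ := mulVec_surjective_of_linearIndependent_rows B hB z
    exact ⟨(y, δ, w), by rw [hT]; simp only at hδ; rw [hδ]⟩
  have hUo : IsOpen U := by
    have : U = (⋂ q, {z | (A *ᵥ z.2.1) q < z.1 q}) ∩ {z | z.2.1 i < z.2.2} := by
      ext z; simp [U]
    rw [this]
    refine (isOpen_iInter_of_finite fun q => isOpen_lt ?_ ?_).inter (isOpen_lt ?_ ?_)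
    · simp only [mulVec, dotProduct]; fun_prop
    · fun_prop
    · fun_prop
    · fun_prop
  have hUc : Convex ℝ U := by
    rintro ⟨y, δ, w⟩ ⟨h1, h2⟩ ⟨y', δ', w'⟩ ⟨h1', h2'⟩ s t hs ht hst
    have key : ∀ {u v u' v' : ℝ}, u < v → u' < v' → s * u + t * u' < s * v + t * v' := by
      intro u v u' v' huv huv'
      rcases hs.eq_or_lt with rfl | hs
      · have : t = 1 := by linarith
        subst this; linarith
      · have := mul_lt_mul_of_pos_left huv hs
        have := mul_le_mul_of_nonneg_left huv'.le ht
        linarith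
    refine ⟨fun q => ?_, ?_⟩
    · simpa [mulVec_add, mulVec_smul] using key (h1 q) (h1' q)
    · simpa using key h2 h2'
  have hpt : (a, b, c) ∉ T '' U := by
    rintro ⟨⟨y, δ, w⟩, ⟨h1, h2⟩, h3⟩
    rw [hT] at h3
    simp only [Prod.mk.injEq] at h3
    obtain ⟨rfl, h3, rfl⟩ := h3
    exact h ⟨δ, h1, h3, h2⟩
  obtain ⟨f, hf⟩ := geometric_hahn_banach_open_point (hUc.linear_image T)
    (T.isOpenMap_of_finiteDimensional hTs U hUo) hpt
  let f₁ : (κ → ℝ) →ₗ[ℝ] ℝ := f.toLinearMap ∘ₗ LinearMap.inl ℝ _ _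
  let f₂ : (β → ℝ) →ₗ[ℝ] ℝ := f.toLinearMap ∘ₗ LinearMap.inr ℝ _ _ ∘ₗ LinearMap.inl ℝ _ _
  let f₃ : ℝ →ₗ[ℝ] ℝ := f.toLinearMap ∘ₗ LinearMap.inr ℝ _ _ ∘ₗ LinearMap.inr ℝ _ _
  have hdec : ∀ y z w, f (y, z, w) = (fun j => f₁ (Pi.single j 1)) ⬝ᵥ y +
      (fun j => f₂ (Pi.single j 1)) ⬝ᵥ z + f₃ 1 * w := by
    intro y z w
    rw [← linearMap_pi_eq_dotProduct f₁, ← linearMap_pi_eq_dotProduct f₂]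
    have h3 : f₃ 1 * w = f₃ w := by
      rw [mul_comm, ← smul_eq_mul, ← map_smul, smul_eq_mul, mul_one]
    rw [h3]
    change f (y, z, w) = f (y, 0) + f (0, (z, 0)) + f (0, (0, w))
    rw [← map_add, ← map_add]
    simp
  refine ⟨fun j => f₁ (Pi.single j 1), fun j => f₂ (Pi.single j 1), f₃ 1, fun δ y w hy hw => ?_⟩
  -- The points of `U` are exactly those given by `δ` and positive slacks above `A δ` and `δ i`.
  have := hf (T (A *ᵥ δ + y, δ, δ i + w)) ⟨_, ⟨fun q => by simpa using hy q, by simpa using hw⟩, rfl⟩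
  rw [hT, hdec, hdec, dotProduct_add, mul_add] at this
  linarith

/-- Under a Slater-type condition, either a system of strict linear inequalities and linear
equations has a solution with `δ i < c`, or there is a dual certificate for the bound `c`. -/
theorem exists_direction_or_exists_dual (A : Matrix κ (Fin n) ℝ) (B : Matrix β (Fin n) ℝ)
    (hB : LinearIndependent ℝ B) {σ : Fin n → ℝ} (hA : ∀ q, (A *ᵥ σ) q < 0) (hBσ : B *ᵥ σ = 0)
    (i : Fin n) (a : κ → ℝ) (b : β → ℝ) (c : ℝ) :
    (∃ δ, (∀ q, (A *ᵥ δ) q < a q) ∧ B *ᵥ δ = b ∧ δ i < c) ∨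
    ∃ v : κ ⊕ β → ℝ, Aᵀ *ᵥ (fun q => v (Sum.inl q)) + Bᵀ *ᵥ (fun q => v (Sum.inr q)) =
        Pi.single i 1 ∧ (∀ q, v (Sum.inl q) ≤ 0) ∧
      c ≤ a ⬝ᵥ (fun q => v (Sum.inl q)) + b ⬝ᵥ (fun q => v (Sum.inr q)) := by
  classical
  refine or_iff_not_imp_left.mpr fun h => ?_
  obtain ⟨μ, ν, τ, H⟩ := exists_multipliers_of_not_exists A B hB i a b c h
  set K := μ ⬝ᵥ a + ν ⬝ᵥ b + τ * c with hK
  have hK0 : 0 ≤ K := by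
    refine nonneg_of_forall_pos_mul_lt (a := μ ⬝ᵥ 1 + τ) fun s hs => ?_
    have := H 0 (s • 1) s (fun q => by simpa using hs) hs
    simp only [mulVec_zero, dotProduct_zero, Pi.zero_apply, mul_zero, dotProduct_smul,
      smul_eq_mul, zero_add] at this
    linarith
  have hμ : ∀ q, μ q ≤ 0 := by
    intro q
    refine nonpos_of_forall_pos_mul_lt (K := K - μ ⬝ᵥ 1 - τ) fun s hs => ?_
    have := H 0 (1 + Pi.single q s) 1 (fun q' => by
      have : 0 ≤ (Pi.single q s : κ → ℝ) q' := by
        rw [Pi.single_apply]; split_ifs <;> linarith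
      simp only [Pi.add_apply, Pi.one_apply]; linarith) one_pos
    simp only [mulVec_zero, dotProduct_zero, Pi.zero_apply, mul_zero, dotProduct_add,
      dotProduct_single, zero_add, mul_one] at this
    linarith
  have hτ : τ ≤ 0 := by
    refine nonpos_of_forall_pos_mul_lt (K := K - μ ⬝ᵥ 1) fun s hs => ?_
    have := H 0 1 s (fun q => by simp) hs
    simp only [mulVec_zero, dotProduct_zero, Pi.zero_apply, mul_zero, zero_add] at this
    linarith
  -- A linear functional bounded above on every ray is nonpositive; applied to `-δ` as well, it
  -- vanishes.
  have hℓle : ∀ δ, μ ⬝ᵥ (A *ᵥ δ) + ν ⬝ᵥ (B *ᵥ δ) + τ * δ i ≤ 0 := by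
    intro δ
    refine nonpos_of_forall_pos_mul_lt (K := K - μ ⬝ᵥ 1 - τ) fun s hs => ?_
    have := H (s • δ) 1 1 (fun q => by simp) one_pos
    simp only [mulVec_smul, dotProduct_smul, smul_eq_mul, Pi.smul_apply] at this
    linarith
  have hℓ : ∀ δ, μ ⬝ᵥ (A *ᵥ δ) + ν ⬝ᵥ (B *ᵥ δ) + τ * δ i = 0 := by
    intro δ
    refine le_antisymm (hℓle δ) ?_
    have := hℓle (-δ)
    simp only [mulVec_neg, dotProduct_neg, Pi.neg_apply, mul_neg] at this
    linarith
  have hvec : ∀ m, (Aᵀ *ᵥ μ) m + (Bᵀ *ᵥ ν) m + τ * (Pi.single i 1 : Fin n → ℝ) m = 0 := by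
    intro m
    have := hℓ (Pi.single m 1)
    rw [dotProduct_mulVec, dotProduct_mulVec, dotProduct_single, dotProduct_single, mul_one,
      mul_one] at this
    have hs : (Pi.single m 1 : Fin n → ℝ) i = (Pi.single i 1 : Fin n → ℝ) m := by
      simp [Pi.single_apply, eq_comm]
    rwa [hs, ← mulVec_transpose, ← mulVec_transpose] at this
  -- If `τ = 0`, the terms of `μ ⬝ᵥ (A *ᵥ σ)` are nonnegative with sum zero, so `μ = 0`;
  -- independence of the rows of `B` then gives `ν = 0`, and the strict separation reads `0 < 0`.
  have hτne : τ ≠ 0 := by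
    intro hτ0
    have h1 := hℓ σ
    rw [hBσ, hτ0, dotProduct_zero, zero_mul, add_zero, add_zero] at h1
    have hμ0 : μ = 0 := by
      have hnn : ∀ q ∈ Finset.univ, 0 ≤ μ q * (A *ᵥ σ) q :=
        fun q _ => mul_nonneg_of_nonpos_of_nonpos (hμ q) (hA q).le
      have h2 := (Finset.sum_eq_zero_iff_of_nonneg hnn).mp h1
      ext q
      exact (mul_eq_zero.mp (h2 q (Finset.mem_univ q))).resolve_right (hA q).ne
    have hν0 : ν = 0 := by
      have h3 : ν ᵥ* B = 0 := by
        ext m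
        have := hvec m
        rw [hμ0, hτ0, mulVec_transpose, mulVec_transpose] at this
        simpa using this
      exact Matrix.vecMul_injective_iff.mpr hB (by simpa using h3)
    have := H 0 1 1 (fun q => by simp) one_pos
    rw [hK, hμ0, hν0, hτ0] at this
    simp at this
  have hτneg : τ < 0 := lt_of_le_of_ne hτ hτne
  -- Dividing by `-τ > 0` normalizes the coefficient of `δ i`; the bound on `c` is `0 ≤ K`.
  refine ⟨Sum.elim ((-τ)⁻¹ • μ) ((-τ)⁻¹ • ν), ?_, ?_, ?_⟩
  · ext m
    have := hvec m
    simp only [Sum.elim_inl, Sum.elim_inr, Pi.add_apply]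
    change (Aᵀ *ᵥ ((-τ)⁻¹ • μ)) m + (Bᵀ *ᵥ ((-τ)⁻¹ • ν)) m = _
    rw [mulVec_smul, mulVec_smul, Pi.smul_apply, Pi.smul_apply, smul_eq_mul, smul_eq_mul]
    have h2 : (Aᵀ *ᵥ μ) m + (Bᵀ *ᵥ ν) m = (-τ) * (Pi.single i 1 : Fin n → ℝ) m := by linarith
    rw [← mul_add, h2, ← mul_assoc, inv_mul_cancel₀ (by linarith), one_mul]
  · intro q
    simp only [Sum.elim_inl, Pi.smul_apply, smul_eq_mul]
    exact mul_nonpos_of_nonneg_of_nonpos (inv_nonneg.mpr (by linarith)) (hμ q)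
  · change c ≤ a ⬝ᵥ ((-τ)⁻¹ • μ) + b ⬝ᵥ ((-τ)⁻¹ • ν)
    rw [dotProduct_smul, dotProduct_smul, ← smul_add, smul_eq_mul, dotProduct_comm a,
      dotProduct_comm b, inv_mul_eq_div, le_div_iff₀ (by linarith)]
    linarith

end Alternative

/-! ### Directional derivatives of maxima of linear functions over compact sets -/

theorem HasDirDeriv.unique {n : ℕ} {f : (Fin n → ℝ) → ℝ} {x d : Fin n → ℝ} {u v : ℝ}
    (hu : HasDirDeriv f x d u) (hv : HasDirDeriv f x d v) : u = v :=
  tendsto_nhds_unique hu hv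

theorem IsHomogSeq.unique {n r : ℕ} {f : (Fin n → ℝ) → ℝ} {x : Fin n → ℝ}
    {M : Matrix (Fin n) (Fin r) ℝ} {φ ψ : Fin (r + 1) → (Fin n → ℝ) → ℝ}
    (hφ : IsHomogSeq f x M φ) (hψ : IsHomogSeq f x M ψ) : φ = ψ := by
  funext j
  induction j using Fin.induction with
  | zero => exact funext fun d => (hφ.1 d).unique (hψ.1 d)
  | succ k ih =>
    refine funext fun d => (hφ.2 k d).unique ?_
    rw [ih]
    exact hψ.2 k d

theorem IsCompact.argmaxOn {E : Type*} [TopologicalSpace E] {C : Set E} (hC : IsCompact C)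
    {c : E → ℝ} (hc : Continuous c) : IsCompact (argmaxOn C c) := by
  have : _root_.argmaxOn C c = C ∩ ⋂ u ∈ C, {v | c u ≤ c v} := by
    ext v; simp [_root_.argmaxOn]
  rw [this]
  exact hC.inter_right (isClosed_biInter fun u _ => isClosed_le continuous_const hc)

theorem IsCompact.argmaxOn_nonempty {E : Type*} [TopologicalSpace E] {C : Set E}
    (hC : IsCompact C) (hne : C.Nonempty) {c : E → ℝ} (hc : Continuous c) :
    (_root_.argmaxOn C c).Nonempty := by
  obtain ⟨v, hv, h⟩ := hC.exists_isMaxOn hne hc.continuousOn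
  exact ⟨v, hv, fun u hu => h hu⟩

/-- Danskin's theorem for the support function of (the image of) a compact set. -/
theorem hasDirDeriv_max_of_compact {ι : Type*} [Fintype ι] {n : ℕ} (G : Matrix ι (Fin n) ℝ)
    {C : Set (ι → ℝ)} (hC : IsCompact C) {ψ : (Fin n → ℝ) → ℝ}
    (hψ : ∀ d, IsGreatest ((fun v => (G *ᵥ d) ⬝ᵥ v) '' C) (ψ d)) (m d : Fin n → ℝ) {c : ℝ}
    (hc : IsGreatest ((fun v => (G *ᵥ d) ⬝ᵥ v) '' argmaxOn C fun v => (G *ᵥ m) ⬝ᵥ v) c) :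
    HasDirDeriv ψ m d c := by
  have hexp : ∀ (t : ℝ) (v : ι → ℝ),
      (G *ᵥ (m + t • d)) ⬝ᵥ v = (G *ᵥ m) ⬝ᵥ v + t * ((G *ᵥ d) ⬝ᵥ v) := by
    intro t v
    rw [mulVec_add, mulVec_smul, add_dotProduct, smul_dotProduct, smul_eq_mul]
  have hcont : ∀ u : ι → ℝ, Continuous fun v : ι → ℝ => u ⬝ᵥ v := fun u => by
    simp only [dotProduct]; fun_prop
  obtain ⟨v₀, ⟨hv₀C, hv₀⟩, hv₀c⟩ := hc.1
  simp only at hv₀c hv₀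
  have hm : (G *ᵥ m) ⬝ᵥ v₀ = ψ m := by
    obtain ⟨w, hw, hwm⟩ := (hψ m).1
    exact le_antisymm ((hψ m).2 ⟨v₀, hv₀C, rfl⟩) (hwm ▸ hv₀ w hw)
  -- points of `C` that are nearly optimal for `m` are nearly below `c` for `d`
  have hnear : ∀ ε > 0, ∃ η > 0, ∀ v ∈ C, ψ m - η < (G *ᵥ m) ⬝ᵥ v → (G *ᵥ d) ⬝ᵥ v < c + ε := by
    intro ε hε
    have hK : IsCompact (C ∩ {v | c + ε ≤ (G *ᵥ d) ⬝ᵥ v}) :=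
      hC.inter_right (isClosed_le continuous_const (hcont _))
    rcases (C ∩ {v | c + ε ≤ (G *ᵥ d) ⬝ᵥ v}).eq_empty_or_nonempty with he | hne
    · refine ⟨1, one_pos, fun v hv _ => ?_⟩
      by_contra! hcon
      exact (he ▸ (⟨hv, hcon⟩ : v ∈ C ∩ {v | c + ε ≤ (G *ᵥ d) ⬝ᵥ v}) : v ∈ (∅ : Set (ι → ℝ)))
    · obtain ⟨w, ⟨hwC, hw⟩, hmax⟩ := hK.exists_isMaxOn hne (hcont (G *ᵥ m)).continuousOn
      have hlt : (G *ᵥ m) ⬝ᵥ w < ψ m := by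
        by_contra! hge
        have : (G *ᵥ d) ⬝ᵥ w ≤ c :=
          hc.2 ⟨w, ⟨hwC, fun u hu => ((hψ m).2 ⟨u, hu, rfl⟩).trans hge⟩, rfl⟩
        have hw' : c + ε ≤ (G *ᵥ d) ⬝ᵥ w := hw
        linarith
      -- `w` is best for `m` among the points whose value for `d` is at least `c + ε`. It is not a
      -- maximizer for `m`, so this gap is positive.
      refine ⟨ψ m - (G *ᵥ m) ⬝ᵥ w, by linarith, fun v hv hv' => ?_⟩
      by_contra! hcon
      have : (G *ᵥ m) ⬝ᵥ v ≤ (G *ᵥ m) ⬝ᵥ w := hmax ⟨hv, hcon⟩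
      linarith
  have hlow : ∀ t > 0, t * c ≤ ψ (m + t • d) - ψ m := by
    intro t _
    have : (G *ᵥ (m + t • d)) ⬝ᵥ v₀ ≤ ψ (m + t • d) := (hψ _).2 ⟨v₀, hv₀C, rfl⟩
    rw [hexp, hm, hv₀c] at this
    linarith
  rw [HasDirDeriv, tendsto_order]
  refine ⟨fun a ha => ?_, fun a ha => ?_⟩
  · filter_upwards [self_mem_nhdsWithin] with t (ht : 0 < t)
    rw [lt_div_iff₀ ht]
    have := hlow t ht
    have := mul_lt_mul_of_pos_left ha ht
    linarith
  · obtain ⟨η, hη, hη'⟩ := hnear (a - c) (by linarith)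
    have hlim : Tendsto (fun t : ℝ => t * (ψ d - c)) (𝓝[>] 0) (𝓝 (0 * (ψ d - c))) :=
      ((continuous_id.mul continuous_const).tendsto 0).mono_left nhdsWithin_le_nhds
    rw [zero_mul] at hlim
    filter_upwards [self_mem_nhdsWithin, hlim.eventually_lt_const hη] with t (ht : 0 < t) htη
    obtain ⟨w, hwC, hw⟩ := (hψ (m + t • d)).1
    simp only [hexp] at hw
    have h1 := hlow t ht
    have h2 : (G *ᵥ d) ⬝ᵥ w ≤ ψ d := (hψ d).2 ⟨w, hwC, rfl⟩
    have h3 : (G *ᵥ m) ⬝ᵥ w ≤ ψ m := (hψ m).2 ⟨w, hwC, rfl⟩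
    -- The maximizer `w` at `m + t • d` loses at most `t * (ψ d - c) < η` in the objective for `m`,
    -- so it is nearly optimal there.
    have h4 := hη' w hwC (by nlinarith [mul_le_mul_of_nonneg_left h2 ht.le])
    rw [div_lt_iff₀ ht]
    nlinarith [mul_lt_mul_of_pos_left h4 ht]

/-! ### The homogenization sequence attached to a compact dual feasible set -/

section Homogenization

variable {ι : Type*} [Fintype ι] {n r : ℕ}

theorem continuous_dotProduct_right (u : ι → ℝ) : Continuous fun v : ι → ℝ => u ⬝ᵥ v := by
  simp only [dotProduct]; fun_prop

/-- Successive sets of maximizers over `C` of the linear functions given by the columns of `M`. -/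
def iteratedArgmax (G : Matrix ι (Fin n) ℝ) (M : Matrix (Fin n) (Fin r) ℝ) (C : Set (ι → ℝ))
    (j : Fin (r + 1)) : Set (ι → ℝ) :=
  Fin.induction (motive := fun _ => Set (ι → ℝ)) C
    (fun k D => argmaxOn D fun v => (G *ᵥ M.col k) ⬝ᵥ v) j

theorem iteratedArgmax_zero (G : Matrix ι (Fin n) ℝ) (M : Matrix (Fin n) (Fin r) ℝ)
    (C : Set (ι → ℝ)) : iteratedArgmax G M C 0 = C := rfl

theorem iteratedArgmax_succ (G : Matrix ι (Fin n) ℝ) (M : Matrix (Fin n) (Fin r) ℝ)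
    (C : Set (ι → ℝ)) (k : Fin r) : iteratedArgmax G M C k.succ =
      argmaxOn (iteratedArgmax G M C k.castSucc) fun v => (G *ᵥ M.col k) ⬝ᵥ v := by
  simp [iteratedArgmax, Fin.induction_succ]

variable {G : Matrix ι (Fin n) ℝ} {C : Set (ι → ℝ)}

theorem isCompact_iteratedArgmax (hC : IsCompact C) (M : Matrix (Fin n) (Fin r) ℝ)
    (j : Fin (r + 1)) : IsCompact (iteratedArgmax G M C j) := by
  induction j using Fin.induction with
  | zero => exact hC
  | succ k ih =>
    rw [iteratedArgmax_succ]
    exact ih.argmaxOn (continuous_dotProduct_right _)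

theorem nonempty_iteratedArgmax (hC : IsCompact C) (hne : C.Nonempty)
    (M : Matrix (Fin n) (Fin r) ℝ) (j : Fin (r + 1)) : (iteratedArgmax G M C j).Nonempty := by
  induction j using Fin.induction with
  | zero => exact hne
  | succ k ih =>
    rw [iteratedArgmax_succ]
    exact (isCompact_iteratedArgmax hC M _).argmaxOn_nonempty ih (continuous_dotProduct_right _)

theorem isGreatest_sSup_linear (hC : IsCompact C) (hne : C.Nonempty) (d : Fin n → ℝ) :
    IsGreatest ((fun v => (G *ᵥ d) ⬝ᵥ v) '' C) (sSup ((fun v => (G *ᵥ d) ⬝ᵥ v) '' C)) :=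
  (hC.image (continuous_dotProduct_right _)).isGreatest_sSup (hne.image _)

/-- If the directional derivative of `f` at `x` is the maximum of linear functions over a compact
set, then the homogenization sequence consists of the maxima over the successive argmax sets. -/
theorem isHomogSeq_iteratedArgmax (hC : IsCompact C) (hne : C.Nonempty) {f : (Fin n → ℝ) → ℝ}
    {x : Fin n → ℝ}
    (hf : ∀ d, HasDirDeriv f x d (sSup ((fun v => (G *ᵥ d) ⬝ᵥ v) '' C)))
    (M : Matrix (Fin n) (Fin r) ℝ) :
    IsHomogSeq f x M fun j d => sSup ((fun v => (G *ᵥ d) ⬝ᵥ v) '' iteratedArgmax G M C j) := by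
  refine ⟨hf, fun k d => ?_⟩
  refine hasDirDeriv_max_of_compact G (isCompact_iteratedArgmax hC M k.castSucc)
    (fun d => isGreatest_sSup_linear (isCompact_iteratedArgmax hC M _)
      (nonempty_iteratedArgmax hC hne M _) d) _ _ ?_
  rw [← iteratedArgmax_succ]
  exact isGreatest_sSup_linear (isCompact_iteratedArgmax hC M _)
      (nonempty_iteratedArgmax hC hne M _) d

/-- Maximizing over a stage amounts to reaching its maximal value, so each argmax step adds one
linear inequality to the previous constraints. -/
theorem mem_iteratedArgmax_iff (hC : IsCompact C) (hne : C.Nonempty)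
    (M : Matrix (Fin n) (Fin r) ℝ) (j : Fin (r + 1)) (v : ι → ℝ) :
    v ∈ iteratedArgmax G M C j ↔ v ∈ C ∧ ∀ k : Fin r, k.castSucc < j →
      sSup ((fun v => (G *ᵥ M.col k) ⬝ᵥ v) '' iteratedArgmax G M C k.castSucc) ≤
        (G *ᵥ M.col k) ⬝ᵥ v := by
  induction j using Fin.induction with
  | zero => simp [iteratedArgmax_zero]
  | succ k ih =>
    have hgr := isGreatest_sSup_linear (G := G) (isCompact_iteratedArgmax (G := G) hC M k.castSucc)
      (nonempty_iteratedArgmax hC hne M k.castSucc) (M.col k)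
    rw [iteratedArgmax_succ]
    constructor
    · rintro ⟨hv, hmax⟩
      obtain ⟨hvC, hv'⟩ := ih.mp hv
      refine ⟨hvC, fun k' hk' => ?_⟩
      rcases (Fin.castSucc_lt_succ_iff.mp hk').lt_or_eq with hlt | rfl
      · exact hv' k' (Fin.castSucc_lt_castSucc_iff.mpr hlt)
      · obtain ⟨w, hw, hwe⟩ := hgr.1
        rw [← hwe]
        exact hmax w hw
    · rintro ⟨hvC, hv⟩
      refine ⟨ih.mpr ⟨hvC, fun k' hk' => hv k' (hk'.trans Fin.castSucc_lt_succ)⟩, fun u hu => ?_⟩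
      exact (hgr.2 ⟨u, hu, rfl⟩).trans (hv k Fin.castSucc_lt_succ)

theorem dotProduct_eq_of_mem_iteratedArgmax (hC : IsCompact C) (hne : C.Nonempty)
    (M : Matrix (Fin n) (Fin r) ℝ) {j : Fin (r + 1)} {v : ι → ℝ}
    (hv : v ∈ iteratedArgmax G M C j) (k : Fin r) (hk : k.castSucc < j) :
    (G *ᵥ M.col k) ⬝ᵥ v =
      sSup ((fun v => (G *ᵥ M.col k) ⬝ᵥ v) '' iteratedArgmax G M C k.castSucc) := by
  have h := (mem_iteratedArgmax_iff hC hne M j v).mp hv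
  refine le_antisymm ?_ (h.2 k hk)
  exact (isGreatest_sSup_linear (G := G) (isCompact_iteratedArgmax (G := G) hC M k.castSucc)
      (nonempty_iteratedArgmax hC hne M k.castSucc) (M.col k)).2
    ⟨v, (mem_iteratedArgmax_iff hC hne M _ v).mpr ⟨h.1, fun k' hk' => h.2 k' (hk'.trans hk)⟩, rfl⟩

end Homogenization

/-! ### The dual feasible set -/

section DualFeasible

variable {κ β : Type*} [Fintype κ] [Fintype β] {nx np r : ℕ}

/-- The dual multipliers of the problem of minimizing the `i`-th component. -/
def dualMultipliers (A : Matrix κ (Fin nx) ℝ) (B : Matrix β (Fin nx) ℝ) (i : Fin nx) :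
    Set (κ ⊕ β → ℝ) :=
  {v | Aᵀ *ᵥ (fun a => v (Sum.inl a)) + Bᵀ *ᵥ (fun b => v (Sum.inr b)) = Pi.single i 1 ∧
    ∀ a, v (Sum.inl a) ≤ 0}

variable {A : Matrix κ (Fin nx) ℝ} {B : Matrix β (Fin nx) ℝ} {i : Fin nx}

/-- The dual equation paired with `δ`; both weak duality and the bounds on multipliers rest on it.
-/
theorem apply_eq_of_mem_dualMultipliers {v : κ ⊕ β → ℝ} (hv : v ∈ dualMultipliers A B i)
    (δ : Fin nx → ℝ) :
    δ i = (fun a => v (Sum.inl a)) ⬝ᵥ (A *ᵥ δ) + (fun b => v (Sum.inr b)) ⬝ᵥ (B *ᵥ δ) := by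
  have h := congrArg (fun u => u ⬝ᵥ δ) hv.1
  simp only [add_dotProduct, mulVec_transpose, ← dotProduct_mulVec, single_dotProduct,
    one_mul] at h
  exact h.symm

/-- Pairing with `σ` writes `σ i` as a sum of nonnegative terms `v_q (A σ)_q`, which bounds each
`v_q`. Pairing with a preimage under `B` of a unit vector then bounds each equality multiplier. -/
theorem isCompact_dualMultipliers (hB : LinearIndependent ℝ B) {σ : Fin nx → ℝ}
    (hA : ∀ q, (A *ᵥ σ) q < 0) (hBσ : B *ᵥ σ = 0) (i : Fin nx) :
    IsCompact (dualMultipliers A B i) := by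
  classical
  have hcl : IsClosed (dualMultipliers A B i) := by
    have : dualMultipliers A B i = {v : κ ⊕ β → ℝ | Aᵀ *ᵥ (fun a => v (Sum.inl a)) +
        Bᵀ *ᵥ (fun b => v (Sum.inr b)) = Pi.single i 1} ∩ ⋂ a, {v | v (Sum.inl a) ≤ 0} := by
      ext v; simp [dualMultipliers]
    rw [this]
    refine (isClosed_eq ?_ continuous_const).inter (isClosed_iInter fun a =>
      isClosed_le (continuous_apply _) continuous_const)
    refine continuous_pi fun m => ?_
    simp only [mulVec, dotProduct, Pi.add_apply]; fun_prop
  have hA' : ∀ v ∈ dualMultipliers A B i, ∀ q, |v (Sum.inl q)| ≤ σ i / -(A *ᵥ σ) q := by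
    intro v hv q
    have h := apply_eq_of_mem_dualMultipliers hv σ
    rw [hBσ, dotProduct_zero, add_zero] at h
    have h1 : v (Sum.inl q) * (A *ᵥ σ) q ≤ σ i := by
      rw [h]
      exact Finset.single_le_sum (f := fun q => v (Sum.inl q) * (A *ᵥ σ) q)
        (fun q _ => mul_nonneg_of_nonpos_of_nonpos (hv.2 q) (hA q).le) (Finset.mem_univ q)
    rw [abs_of_nonpos (hv.2 q), le_div_iff₀ (by linarith [hA q])]
    linarith
  choose R hR using mulVec_surjective_of_linearIndependent_rows B hB
  simp only at hR
  let bd : κ ⊕ β → ℝ := Sum.elim (fun q => σ i / -(A *ᵥ σ) q) fun b =>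
    |R (Pi.single b 1) i| + ∑ q, σ i / -(A *ᵥ σ) q * |(A *ᵥ R (Pi.single b 1)) q|
  have hbd : ∀ v ∈ dualMultipliers A B i, ∀ s, |v s| ≤ bd s := by
    rintro v hv (q | b)
    · exact hA' v hv q
    · have h := apply_eq_of_mem_dualMultipliers hv (R (Pi.single b 1))
      rw [hR, dotProduct_single, mul_one] at h
      have h1 : v (Sum.inr b) = R (Pi.single b 1) i -
          (fun a => v (Sum.inl a)) ⬝ᵥ (A *ᵥ R (Pi.single b 1)) := by linarith
      rw [h1]
      refine (abs_sub _ _).trans (add_le_add le_rfl ?_)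
      refine (Finset.abs_sum_le_sum_abs _ _).trans (Finset.sum_le_sum fun q _ => ?_)
      rw [abs_mul]
      exact mul_le_mul_of_nonneg_right (hA' v hv q) (abs_nonneg _)
  refine (isCompact_univ_pi fun s => isCompact_Icc (a := -bd s) (b := bd s)).of_isClosed_subset hcl
    fun v hv s _ => abs_le.mp (hbd v hv s)

/-- The programs refer to the values `φ` that they are to compute; with `φ` defined through the
argmax sets this is no circularity. -/
theorem dualFeasible_eq_iteratedArgmax {G : Matrix (κ ⊕ β) (Fin np) ℝ}
    (hC : IsCompact (dualMultipliers A B i)) (hne : (dualMultipliers A B i).Nonempty)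
    (M : Matrix (Fin np) (Fin r) ℝ) (j : Fin (r + 1)) :
    dualFeasible A B G i M (fun j d => sSup ((fun v => (G *ᵥ d) ⬝ᵥ v) ''
      iteratedArgmax G M (dualMultipliers A B i) j)) j =
      iteratedArgmax G M (dualMultipliers A B i) j := by
  ext v
  rw [mem_iteratedArgmax_iff hC hne]
  simp [dualFeasible, dualMultipliers, and_assoc]

end DualFeasible

/-! ### Gradients -/

section Gradients

variable {nx np : ℕ}

theorem fderiv_apply_eq_gradX_add_gradP {F : (Fin nx → ℝ) × (Fin np → ℝ) → ℝ} {ξ : Fin nx → ℝ}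
    {p : Fin np → ℝ} (hF : DifferentiableAt ℝ F (ξ, p)) (δ : Fin nx → ℝ) (d : Fin np → ℝ) :
    fderiv ℝ F (ξ, p) (δ, d) = gradX F ξ p ⬝ᵥ δ + gradP F ξ p ⬝ᵥ d := by
  have h1 : HasFDerivAt (fun ξ' => F (ξ', p))
      ((fderiv ℝ F (ξ, p)).comp (ContinuousLinearMap.inl ℝ (Fin nx → ℝ) (Fin np → ℝ))) ξ :=
    hF.hasFDerivAt.comp ξ (hasFDerivAt_prodMk_left ξ p)
  have h2 : HasFDerivAt (fun p' => F (ξ, p'))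
      ((fderiv ℝ F (ξ, p)).comp (ContinuousLinearMap.inr ℝ (Fin nx → ℝ) (Fin np → ℝ))) p :=
    hF.hasFDerivAt.comp p (hasFDerivAt_prodMk_right ξ p)
  unfold gradX gradP
  rw [h1.fderiv, h2.fderiv]
  erw [← linearMap_pi_eq_dotProduct ((fderiv ℝ F (ξ, p)).comp
      (ContinuousLinearMap.inl ℝ (Fin nx → ℝ) (Fin np → ℝ))).toLinearMap,
    ← linearMap_pi_eq_dotProduct ((fderiv ℝ F (ξ, p)).comp
      (ContinuousLinearMap.inr ℝ (Fin nx → ℝ) (Fin np → ℝ))).toLinearMap]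
  change _ = fderiv ℝ F (ξ, p) (δ, 0) + fderiv ℝ F (ξ, p) (0, d)
  rw [← map_add]
  simp

theorem DifferentiableAt.tendsto_slope_line {E : Type*} [NormedAddCommGroup E] [NormedSpace ℝ E]
    {F : E → ℝ} {z : E} (hF : DifferentiableAt ℝ F z) (w : E) :
    Tendsto (fun t : ℝ => (F (z + t • w) - F z) / t) (𝓝[>] 0) (𝓝 (fderiv ℝ F z w)) := by
  have h := (hF.hasFDerivAt.hasLineDerivAt w).tendsto_slope_zero_right
  simpa [inv_mul_eq_div] using h

theorem ConvexOn.add_fderiv_le {E : Type*} [NormedAddCommGroup E] [NormedSpace ℝ E]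
    {F : E → ℝ} (hc : ConvexOn ℝ univ F) {z : E} (hF : DifferentiableAt ℝ F z) (w : E) :
    F z + fderiv ℝ F z w ≤ F (z + w) := by
  suffices fderiv ℝ F z w ≤ F (z + w) - F z by linarith
  refine le_of_tendsto (hF.tendsto_slope_line w) ?_
  filter_upwards [Ioc_mem_nhdsGT (one_pos : (0 : ℝ) < 1)] with t ht
  have h := hc.2 (mem_univ z) (mem_univ (z + w)) (sub_nonneg.mpr ht.2) ht.1.le (by ring)
  have e : (1 - t) • z + t • (z + w) = z + t • w := by module
  rw [e] at h
  simp only [smul_eq_mul] at h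
  rw [div_le_iff₀ ht.1]
  linarith

end Gradients

/-! ### Differentiability and convexity of the constraint functions -/

namespace ImplicitSystem

variable {nx np nf nh : ℕ} {S : ImplicitSystem nx np nf nh}

theorem differentiable_g (hR : S.IsPiecewiseDiffRelaxed) (q : S.IneqIdx) :
    Differentiable ℝ (S.g q) := by
  rcases q with ⟨a, j⟩ | ⟨a, j⟩ | m | m
  · exact (hR.contDiff_cv a j).differentiable one_ne_zero
  · exact ((hR.contDiff_cc a j).differentiable one_ne_zero).neg
  · change Differentiable ℝ fun z : (Fin nx → ℝ) × (Fin np → ℝ) => S.xL m - z.1 m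
    fun_prop
  · change Differentiable ℝ fun z : (Fin nx → ℝ) × (Fin np → ℝ) => z.1 m - S.xU m
    fun_prop

theorem convexOn_g (hR : S.IsPiecewiseDiffRelaxed) (q : S.IneqIdx) :
    ConvexOn ℝ univ (S.g q) := by
  rcases q with ⟨a, j⟩ | ⟨a, j⟩ | m | m
  · exact hR.convex_cv a j
  · exact (hR.concave_cc a j).neg
  · refine ⟨convex_univ, fun z _ w _ s t _ _ hst => le_of_eq ?_⟩
    obtain rfl : s = 1 - t := by linarith
    simp only [g, Prod.fst_add, Prod.smul_fst, Pi.add_apply, Pi.smul_apply, smul_eq_mul]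
    ring
  · refine ⟨convex_univ, fun z _ w _ s t _ _ hst => le_of_eq ?_⟩
    obtain rfl : s = 1 - t := by linarith
    simp only [g, Prod.fst_add, Prod.smul_fst, Pi.add_apply, Pi.smul_apply, smul_eq_mul]
    ring

theorem g_add_le (hR : S.IsPiecewiseDiffRelaxed) (q : S.IneqIdx) (ξ δ : Fin nx → ℝ)
    (p d : Fin np → ℝ) : S.g q (ξ, p) + (gradX (S.g q) ξ p ⬝ᵥ δ + gradP (S.g q) ξ p ⬝ᵥ d) ≤
      S.g q (ξ + δ, p + d) := by
  have h := (convexOn_g hR q).add_fderiv_le (differentiable_g hR q (ξ, p)) (δ, d)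
  rwa [fderiv_apply_eq_gradX_add_gradP (differentiable_g hR q (ξ, p))] at h

theorem differentiable_h (hR : S.IsPiecewiseDiffRelaxed) (b : Fin nh) :
    Differentiable ℝ (S.h b) := by
  obtain ⟨L, hL⟩ := hR.affine_h b
  rw [funext hL, AffineMap.decomp L]
  exact (LinearMap.toContinuousLinearMap L.linear).differentiable.add (differentiable_const _)

theorem h_add (hR : S.IsPiecewiseDiffRelaxed) (b : Fin nh) (ξ δ : Fin nx → ℝ)
    (p d : Fin np → ℝ) : S.h b (ξ + δ, p + d) =
      S.h b (ξ, p) + (gradX (S.h b) ξ p ⬝ᵥ δ + gradP (S.h b) ξ p ⬝ᵥ d) := by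
  obtain ⟨L, hL⟩ := hR.affine_h b
  -- An affine function is both convex and concave, so the gradient inequality holds in both
  -- directions.
  have hconv : ConvexOn ℝ univ (S.h b) := by
    rw [funext hL]
    exact (convexOn_id convex_univ).comp_affineMap L
  have hconc : ConvexOn ℝ univ (-S.h b) := by
    rw [funext hL]
    exact ((concaveOn_id convex_univ).comp_affineMap L).neg
  have hd := differentiable_h hR b (ξ, p)
  have h1 := hconv.add_fderiv_le hd (δ, d)
  have h2 := hconc.add_fderiv_le hd.neg (δ, d)
  rw [fderiv_neg] at h2
  rw [← fderiv_apply_eq_gradX_add_gradP hd]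
  simp only [Pi.neg_apply, _root_.neg_apply, Prod.mk_add_mk] at h1 h2
  linarith

/-! ### The reformulated problem -/

/-- A maximum is nonpositive exactly when all pieces are, and since `h` is its own relaxation, its
two inequalities form an equation. -/
theorem mem_Ω_iff (hR : S.IsPiecewiseDiffRelaxed) {p : Fin np → ℝ} (hp : p ∈ S.P)
    (ξ : Fin nx → ℝ) :
    ξ ∈ S.Ω p ↔ ξ ∈ S.X ∧ ∀ c, S.fcv c (ξ, p) ≤ 0 ∧ 0 ≤ S.fcc c (ξ, p) := by
  constructor
  · rintro ⟨hh, hg⟩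
    have hX : ξ ∈ S.X := ⟨fun m => sub_nonpos.mp (hg (Sum.inr (Sum.inr (Sum.inl m)))),
      fun m => sub_nonpos.mp (hg (Sum.inr (Sum.inr (Sum.inr m))))⟩
    have hz : (ξ, p) ∈ S.X ×ˢ S.P := ⟨hX, hp⟩
    refine ⟨hX, fun c => ?_⟩
    obtain ⟨a | b, rfl⟩ := S.e.surjective c
    · obtain ⟨j, hj⟩ := (hR.cv_eq_max a _ hz).1
      obtain ⟨l, hl⟩ := (hR.cc_eq_min a _ hz).1
      rw [← hj, ← hl]
      exact ⟨hg (Sum.inl ⟨a, j⟩), neg_nonpos.mp (hg (Sum.inr (Sum.inl ⟨a, l⟩)))⟩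
    · rw [hR.cv_h b _ hz, hR.cc_h b _ hz, hh b]
      simp
  · rintro ⟨hX, hc⟩
    have hz : (ξ, p) ∈ S.X ×ˢ S.P := ⟨hX, hp⟩
    refine ⟨fun b => ?_, ?_⟩
    · have := hc (S.e (Sum.inr b))
      rw [hR.cv_h b _ hz, hR.cc_h b _ hz] at this
      exact le_antisymm this.1 this.2
    · rintro (⟨a, j⟩ | ⟨a, j⟩ | m | m)
      · exact ((hR.cv_eq_max a _ hz).2 ⟨j, rfl⟩).trans (hc _).1
      · exact neg_nonpos.mpr ((hc _).2.trans ((hR.cc_eq_min a _ hz).2 ⟨j, rfl⟩))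
      · exact sub_nonpos.mpr (hX.1 m)
      · exact sub_nonpos.mpr (hX.2 m)

theorem xcv_eq_iInf_Ω (hR : S.IsPiecewiseDiffRelaxed) {p : Fin np → ℝ} (hp : p ∈ S.P)
    (i : Fin nx) : S.xcv i p = ⨅ ξ ∈ S.Ω p, ((ξ i : ℝ) : EReal) := by
  have : S.Ω p = {ξ : Fin nx → ℝ | ξ ∈ S.X ∧ ∀ c, S.fcv c (ξ, p) ≤ 0 ∧ 0 ≤ S.fcc c (ξ, p)} :=
    Set.ext fun ξ => mem_Ω_iff hR hp ξ
  rw [xcv, this]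

theorem isCompact_Ω (hR : S.IsPiecewiseDiffRelaxed) (p : Fin np → ℝ) : IsCompact (S.Ω p) := by
  refine (isCompact_Icc (a := S.xL) (b := S.xU)).of_isClosed_subset ?_ ?_
  · have : S.Ω p = (⋂ b, {ξ | S.h b (ξ, p) = 0}) ∩ ⋂ q, {ξ | S.g q (ξ, p) ≤ 0} := by
      ext ξ; simp only [Ω, mem_ofPred_eq, mem_inter_iff, mem_iInter]
    rw [this]
    refine (isClosed_iInter fun b => isClosed_eq ?_ continuous_const).inter
      (isClosed_iInter fun q => isClosed_le ?_ continuous_const)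
    · exact (differentiable_h hR b).continuous.comp (by fun_prop)
    · exact (differentiable_g hR q).continuous.comp (by fun_prop)
  · exact fun ξ hξ => ⟨fun m => sub_nonpos.mp (hξ.2 (Sum.inr (Sum.inr (Sum.inl m)))),
      fun m => sub_nonpos.mp (hξ.2 (Sum.inr (Sum.inr (Sum.inr m))))⟩

/-- The relaxations enclose the residual, which vanishes at `x p`. This gives feasibility on `Q`. -/
theorem x_mem_Ω (hS : S.IsImplicitSetup) (hR : S.IsPiecewiseDiffRelaxed) {p : Fin np → ℝ}
    (hp : p ∈ S.Q) : S.x p ∈ S.Ω p := by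
  rw [mem_Ω_iff hR hp.1]
  have hX := hS.mem_box p hp
  have h0 : ∀ c, S.f (S.x p, p) c = 0 := fun c => congrFun (hS.solves p hp) c
  refine ⟨hX, fun c => ⟨?_, ?_⟩⟩
  · exact ((hR.relax_cv c).1 _ ⟨hX, hp.1⟩).trans_eq (h0 c)
  · exact (h0 c).symm.trans_le ((hR.relax_cc c).1 _ ⟨hX, hp.1⟩)

theorem exists_isOptimal (hS : S.IsImplicitSetup) (hR : S.IsPiecewiseDiffRelaxed) {p : Fin np → ℝ}
    (hp : p ∈ S.Q) (i : Fin nx) : ∃ ξ, S.IsOptimal i p ξ := by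
  obtain ⟨ξ, hξ, h⟩ := (isCompact_Ω hR p).exists_isMinOn ⟨_, x_mem_Ω hS hR hp⟩
    (continuous_apply i).continuousOn
  exact ⟨ξ, hξ, fun η hη => h hη⟩

theorem IsOptimal.xcv_eq (hR : S.IsPiecewiseDiffRelaxed) {p : Fin np → ℝ} (hp : p ∈ S.P)
    {i : Fin nx} {ξ : Fin nx → ℝ} (h : S.IsOptimal i p ξ) :
    S.xcv i p = ((ξ i : ℝ) : EReal) := by
  rw [xcv_eq_iInf_Ω hR hp]
  exact le_antisymm (iInf₂_le ξ h.1) (le_iInf₂ fun η hη => EReal.coe_le_coe_iff.mpr (h.2 η hη))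

theorem IsOptimal.xcvReal_eq (hR : S.IsPiecewiseDiffRelaxed) {p : Fin np → ℝ} (hp : p ∈ S.P)
    {i : Fin nx} {ξ : Fin nx → ℝ} (h : S.IsOptimal i p ξ) : S.xcvReal i p = ξ i := by
  rw [xcvReal, h.xcv_eq hR hp, EReal.toReal_coe]

theorem xcvReal_le (hS : S.IsImplicitSetup) (hR : S.IsPiecewiseDiffRelaxed) {p : Fin np → ℝ}
    (hp : p ∈ S.Q) {i : Fin nx} {ξ : Fin nx → ℝ} (hξ : ξ ∈ S.Ω p) : S.xcvReal i p ≤ ξ i := by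
  obtain ⟨η, hη⟩ := exists_isOptimal hS hR hp i
  rw [hη.xcvReal_eq hR hp.1]
  exact hη.2 ξ hξ

theorem combo_mem_Ω (hR : S.IsPiecewiseDiffRelaxed) {p p' : Fin np → ℝ} {ξ ξ' : Fin nx → ℝ}
    (hξ : ξ ∈ S.Ω p) (hξ' : ξ' ∈ S.Ω p') {s t : ℝ} (hs : 0 ≤ s) (ht : 0 ≤ t) (hst : s + t = 1) :
    s • ξ + t • ξ' ∈ S.Ω (s • p + t • p') := by
  refine ⟨fun b => ?_, fun q => ?_⟩
  · obtain ⟨L, hL⟩ := hR.affine_h b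
    have h := Convex.combo_affine_apply hst (f := L) (x := (ξ, p)) (y := (ξ', p'))
    rw [← hL, ← hL, ← hL, hξ.1 b, hξ'.1 b] at h
    simpa using h
  · refine ((convexOn_g hR q).2 (mem_univ (ξ, p)) (mem_univ (ξ', p')) hs ht hst).trans ?_
    simp only [smul_eq_mul]
    nlinarith [hξ.2 q, hξ'.2 q]

theorem convexOn_xcvReal (hS : S.IsImplicitSetup) (hR : S.IsPiecewiseDiffRelaxed)
    {C : Set (Fin np → ℝ)} (hC : Convex ℝ C) (hCQ : C ⊆ S.Q) (i : Fin nx) :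
    ConvexOn ℝ C (S.xcvReal i) := by
  refine ⟨hC, fun p hp p' hp' s t hs ht hst => ?_⟩
  obtain ⟨ξ, hξ⟩ := exists_isOptimal hS hR (hCQ hp) i
  obtain ⟨ξ', hξ'⟩ := exists_isOptimal hS hR (hCQ hp') i
  rw [hξ.xcvReal_eq hR (hCQ hp).1, hξ'.xcvReal_eq hR (hCQ hp').1]
  exact xcvReal_le hS hR (hCQ (hC hp hp' hs ht hst)) (combo_mem_Ω hR hξ.1 hξ'.1 hs ht hst)

theorem locallyLipschitzOn_xcvReal (hS : S.IsImplicitSetup) (hR : S.IsPiecewiseDiffRelaxed)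
    (i : Fin nx) : LocallyLipschitzOn (interior S.Q) (S.xcvReal i) := by
  intro p hp
  -- `Q` need not be convex, so convexity is used on a ball inside its interior.
  obtain ⟨ε, hε, hball⟩ := Metric.isOpen_iff.mp isOpen_interior p hp
  have hconv := convexOn_xcvReal hS hR (convex_ball p ε) (hball.trans interior_subset) i
  obtain ⟨K, t, ht, hK⟩ := hconv.locallyLipschitzOn Metric.isOpen_ball (Metric.mem_ball_self hε)
  refine ⟨K, t, ?_, hK⟩
  rw [Metric.isOpen_ball.nhdsWithin_eq (Metric.mem_ball_self hε)] at ht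
  exact mem_nhdsWithin_of_mem_nhds ht

/-! ### Linearization at an optimal solution -/

theorem matA_mulVec_apply (ξ : Fin nx → ℝ) (p : Fin np → ℝ) (q : S.ActiveIdx ξ p)
    (δ : Fin nx → ℝ) : (S.matA ξ p *ᵥ δ) q = gradX (S.g q.1) ξ p ⬝ᵥ δ := rfl

theorem matG_mulVec_inl (ξ : Fin nx → ℝ) (p d : Fin np → ℝ) (q : S.ActiveIdx ξ p) :
    (S.matG ξ p *ᵥ d) (Sum.inl q) = -(gradP (S.g q.1) ξ p ⬝ᵥ d) := by
  change (-gradP (S.g q.1) ξ p) ⬝ᵥ d = _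
  rw [neg_dotProduct]

theorem matG_mulVec_inr (ξ : Fin nx → ℝ) (p d : Fin np → ℝ) (b : Fin nh) :
    (S.matG ξ p *ᵥ d) (Sum.inr b) = -(gradP (S.h b) ξ p ⬝ᵥ d) := by
  change (-gradP (S.h b) ξ p) ⬝ᵥ d = _
  rw [neg_dotProduct]

/-- Weak duality: every dual multiplier gives an affine minorant of the value function. -/
theorem add_dual_le_of_mem_Ω (hR : S.IsPiecewiseDiffRelaxed) {p p' : Fin np → ℝ}
    {ξ ξ' : Fin nx → ℝ} {i : Fin nx} (hξ : ξ ∈ S.Ω p) (hξ' : ξ' ∈ S.Ω p')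
    {v : S.ActiveIdx ξ p ⊕ Fin nh → ℝ} (hv : v ∈ dualMultipliers (S.matA ξ p) (S.matB ξ p) i) :
    ξ i + (S.matG ξ p *ᵥ (p' - p)) ⬝ᵥ v ≤ ξ' i := by
  have h := apply_eq_of_mem_dualMultipliers hv (ξ' - ξ)
  have hA : ∀ q, (S.matA ξ p *ᵥ (ξ' - ξ)) q ≤ (S.matG ξ p *ᵥ (p' - p)) (Sum.inl q) := by
    intro q
    have h1 := g_add_le hR q.1 ξ (ξ' - ξ) p (p' - p)
    rw [add_sub_cancel, add_sub_cancel, q.2] at h1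
    rw [matG_mulVec_inl, matA_mulVec_apply]
    linarith [hξ'.2 q.1]
  have hB : ∀ b, (S.matB ξ p *ᵥ (ξ' - ξ)) b = (S.matG ξ p *ᵥ (p' - p)) (Sum.inr b) := by
    intro b
    have h1 := h_add hR b ξ (ξ' - ξ) p (p' - p)
    rw [add_sub_cancel, add_sub_cancel, hξ.1 b, hξ'.1 b] at h1
    rw [matG_mulVec_inr]
    change gradX (S.h b) ξ p ⬝ᵥ (ξ' - ξ) = _
    linarith
  rw [funext hB] at h
  -- The sign `v^A ≤ 0` reverses the linearized inequalities.
  have h2 : (fun b => v (Sum.inl b)) ⬝ᵥ (fun q => (S.matG ξ p *ᵥ (p' - p)) (Sum.inl q)) ≤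
      (fun b => v (Sum.inl b)) ⬝ᵥ (S.matA ξ p *ᵥ (ξ' - ξ)) :=
    Finset.sum_le_sum fun q _ => mul_le_mul_of_nonpos_left (hA q) (hv.2 q)
  have h3 : (S.matG ξ p *ᵥ (p' - p)) ⬝ᵥ v =
      (fun b => v (Sum.inl b)) ⬝ᵥ (fun q => (S.matG ξ p *ᵥ (p' - p)) (Sum.inl q)) +
      (fun b => v (Sum.inr b)) ⬝ᵥ (fun q => (S.matG ξ p *ᵥ (p' - p)) (Sum.inr q)) := by
    simp only [dotProduct, Fintype.sum_sum_type]
    simp only [mul_comm]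
  simp only [Pi.sub_apply] at h
  linarith

/-- Strictly feasible directions of the linearized problem are feasible directions. -/
theorem eventually_add_smul_mem_Ω (hR : S.IsPiecewiseDiffRelaxed) {p d : Fin np → ℝ}
    {ξ δ : Fin nx → ℝ} (hξ : ξ ∈ S.Ω p)
    (hA : ∀ q, (S.matA ξ p *ᵥ δ) q < (S.matG ξ p *ᵥ d) (Sum.inl q))
    (hB : ∀ b, (S.matB ξ p *ᵥ δ) b = (S.matG ξ p *ᵥ d) (Sum.inr b)) :
    ∀ᶠ t : ℝ in 𝓝[>] 0, ξ + t • δ ∈ S.Ω (p + t • d) := by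
  have hg : ∀ q, ∀ᶠ t : ℝ in 𝓝[>] 0, S.g q (ξ + t • δ, p + t • d) ≤ 0 := by
    intro q
    have hd := differentiable_g hR q (ξ, p)
    by_cases hq : S.g q (ξ, p) = 0
    · have h1 := hd.tendsto_slope_line (δ, d)
      rw [fderiv_apply_eq_gradX_add_gradP hd] at h1
      have h2 := hA ⟨q, hq⟩
      rw [matG_mulVec_inl, matA_mulVec_apply] at h2
      filter_upwards [self_mem_nhdsWithin, h1.eventually_lt_const (u := 0) (by linarith)]
        with t (ht : 0 < t) hlt
      rw [hq, sub_zero, div_lt_iff₀ ht, zero_mul] at hlt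
      exact hlt.le
    · have hlt : S.g q (ξ, p) < 0 := lt_of_le_of_ne (hξ.2 q) hq
      have hc : Continuous fun t : ℝ => S.g q (ξ + t • δ, p + t • d) :=
        (differentiable_g hR q).continuous.comp (by fun_prop)
      have h1 := hc.tendsto 0
      simp only [zero_smul, add_zero] at h1
      filter_upwards [(h1.mono_left nhdsWithin_le_nhds).eventually_lt_const hlt] with t ht
      exact ht.le
  filter_upwards [eventually_all.mpr hg] with t ht
  refine ⟨fun b => ?_, ht⟩
  have h1 := hB b
  rw [matG_mulVec_inr] at h1
  change gradX (S.h b) ξ p ⬝ᵥ δ = _ at h1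
  rw [h_add hR, hξ.1 b, dotProduct_smul, dotProduct_smul, h1]
  simp

theorem linearIndependent_matB {phat : Fin np → ℝ} (hSl : S.IsSlater phat) (ξ : Fin nx → ℝ)
    (p : Fin np → ℝ) : LinearIndependent ℝ (S.matB ξ p) :=
  hSl.linearIndependent ξ p

theorem mem_Q_of_isSlater {phat : Fin np → ℝ} (hSl : S.IsSlater phat) : phat ∈ S.Q :=
  interior_subset hSl.mem_interior

/-- By the gradient inequality, the step from `ξ` to a Slater point strictly decreases the
linearization of every active constraint. -/
theorem exists_slater_direction (hR : S.IsPiecewiseDiffRelaxed) {phat : Fin np → ℝ}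
    (hSl : S.IsSlater phat) {ξ : Fin nx → ℝ} (hξ : ξ ∈ S.Ω phat) :
    ∃ σ, (∀ q, (S.matA ξ phat *ᵥ σ) q < 0) ∧ S.matB ξ phat *ᵥ σ = 0 := by
  obtain ⟨N, hN, -, hN'⟩ := hSl.slater
  obtain ⟨η, -, hh, hg⟩ := hN' phat (mem_of_mem_nhds hN)
  refine ⟨η - ξ, fun q => ?_, funext fun b => ?_⟩
  · have h1 := g_add_le hR q.1 ξ (η - ξ) phat 0
    rw [add_sub_cancel, add_zero, q.2, dotProduct_zero] at h1
    rw [matA_mulVec_apply]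
    linarith [hg q.1]
  · have h1 := h_add hR b ξ (η - ξ) phat 0
    rw [add_sub_cancel, add_zero, hξ.1 b, hh b, dotProduct_zero] at h1
    change gradX (S.h b) ξ phat ⬝ᵥ (η - ξ) = 0
    linarith

theorem nonempty_dualMultipliers (hR : S.IsPiecewiseDiffRelaxed) {phat : Fin np → ℝ}
    (hSl : S.IsSlater phat) {i : Fin nx} {ξ : Fin nx → ℝ} (hξ : S.IsOptimal i phat ξ) :
    (dualMultipliers (S.matA ξ phat) (S.matB ξ phat) i).Nonempty := by
  obtain ⟨σ, hσ, hσB⟩ := exists_slater_direction hR hSl hξ.1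
  -- With zero right-hand sides the first alternative is a feasible descent direction, contradicting
  -- optimality.
  rcases exists_direction_or_exists_dual (S.matA ξ phat) (S.matB ξ phat)
    (linearIndependent_matB hSl ξ phat) hσ hσB i 0 0 0 with ⟨δ, h1, h2, h3⟩ | ⟨v, h1, h2, -⟩
  · have hev := eventually_add_smul_mem_Ω (d := 0) (δ := δ) hR hξ.1 (fun q => by
      simpa using h1 q) (fun b => by simp [h2])
    obtain ⟨t, htΩ, ht⟩ := (hev.and self_mem_nhdsWithin).exists
    rw [smul_zero, add_zero] at htΩ
    have h4 := hξ.2 _ htΩ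
    simp only [Pi.add_apply, Pi.smul_apply, smul_eq_mul] at h4
    have ht' : 0 < t := ht
    nlinarith
  · exact ⟨v, h1, h2⟩

/-- The directional derivative of the value function is the maximum over the dual multipliers. -/
theorem hasDirDeriv_xcvReal (hS : S.IsImplicitSetup) (hR : S.IsPiecewiseDiffRelaxed)
    {phat : Fin np → ℝ} (hSl : S.IsSlater phat) {i : Fin nx} {ξ : Fin nx → ℝ}
    (hξ : S.IsOptimal i phat ξ) {d : Fin np → ℝ} {c : ℝ}
    (hc : IsGreatest ((fun v => (S.matG ξ phat *ᵥ d) ⬝ᵥ v) ''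
      dualMultipliers (S.matA ξ phat) (S.matB ξ phat) i) c) :
    HasDirDeriv (S.xcvReal i) phat d c := by
  have hQ := mem_Q_of_isSlater hSl
  have hevQ : ∀ᶠ t : ℝ in 𝓝[>] 0, phat + t • d ∈ S.Q := by
    have hcont : Continuous fun t : ℝ => phat + t • d := by fun_prop
    have h1 := hcont.tendsto 0
    simp only [zero_smul, add_zero] at h1
    exact (h1.mono_left nhdsWithin_le_nhds).eventually
      (mem_interior_iff_mem_nhds.mp hSl.mem_interior)
  rw [HasDirDeriv, hξ.xcvReal_eq hR hQ.1, tendsto_order]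
  refine ⟨fun a ha => ?_, fun a ha => ?_⟩
  · obtain ⟨v, hv, hvc⟩ := hc.1
    filter_upwards [self_mem_nhdsWithin, hevQ] with t (ht : 0 < t) htQ
    obtain ⟨η, hη⟩ := exists_isOptimal hS hR htQ i
    rw [hη.xcvReal_eq hR htQ.1, lt_div_iff₀ ht]
    have h1 := add_dual_le_of_mem_Ω hR hξ.1 hη.1 hv
    rw [add_sub_cancel_left, mulVec_smul, smul_dotProduct, smul_eq_mul] at h1
    simp only at hvc
    rw [hvc] at h1
    nlinarith
  · obtain ⟨σ, hσ, hσB⟩ := exists_slater_direction hR hSl hξ.1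
    -- For `a > c` the dual alternative would have value at least `a`, above the maximum `c`. Hence
    -- there is a direction with `δ i < a`.
    rcases exists_direction_or_exists_dual (S.matA ξ phat) (S.matB ξ phat)
      (linearIndependent_matB hSl ξ phat) hσ hσB i
      (fun q => (S.matG ξ phat *ᵥ d) (Sum.inl q)) (fun b => (S.matG ξ phat *ᵥ d) (Sum.inr b)) a
      with ⟨δ, h1, h2, h3⟩ | ⟨v, h1, h2, h3⟩
    · filter_upwards [self_mem_nhdsWithin, hevQ,
        eventually_add_smul_mem_Ω hR hξ.1 h1 (congrFun h2)] with t (ht : 0 < t) htQ htΩ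
      have h4 := xcvReal_le hS hR htQ (i := i) htΩ
      simp only [Pi.add_apply, Pi.smul_apply, smul_eq_mul] at h4
      rw [div_lt_iff₀ ht]
      nlinarith
    · have h4 : (S.matG ξ phat *ᵥ d) ⬝ᵥ v ≤ c := hc.2 ⟨v, ⟨h1, h2⟩, rfl⟩
      simp only [dotProduct, Fintype.sum_sum_type] at h3 h4
      linarith

end ImplicitSystem

/-! ### Row vectors determined by their products with spanning columns -/

section LinearExtension

variable {n r : ℕ} {ι : Type*} [Fintype ι]

theorem vecMul_eq_vecMul_iff_of_span {M : Matrix (Fin n) (Fin r) ℝ}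
    (hM : Submodule.span ℝ (Set.range M.col) = ⊤) {J J' : Fin n → ℝ} :
    J' ᵥ* M = J ᵥ* M ↔ J' = J := by
  refine ⟨fun h => ?_, fun h => h ▸ rfl⟩
  have hlin : (dotProductBilin ℝ ℝ J' : (Fin n → ℝ) →ₗ[ℝ] ℝ) = dotProductBilin ℝ ℝ J := by
    refine LinearMap.ext_on_range hM fun k => ?_
    exact congrFun h k
  ext m
  have := LinearMap.congr_fun hlin (Pi.single m 1)
  simpa using this

theorem vecMul_mul_apply (G : Matrix ι (Fin n) ℝ) (M : Matrix (Fin n) (Fin r) ℝ) (v : ι → ℝ)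
    (k : Fin r) : (v ᵥ* (G * M)) k = (G *ᵥ M.col k) ⬝ᵥ v := by
  rw [← vecMul_vecMul, dotProduct_comm, dotProduct_mulVec]
  rfl

end LinearExtension

/-! ### Assembly of the main theorem -/

theorem theorem1 {nx np nf nh : ℕ} (S : ImplicitSystem nx np nf nh)
    (hS : S.IsImplicitSetup) (hR : S.IsPiecewiseDiffRelaxed)
    (phat : Fin np → ℝ) (hSl : S.IsSlater phat) (i : Fin nx) :
    -- on `Q`, the relaxation is finite and is the minimum of the reformulated convex program
    (∀ p ∈ S.Q, ∃ ξ, S.IsOptimal i p ξ ∧ S.xcv i p = ((ξ i : ℝ) : EReal)) ∧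
    LSmoothAt (interior S.Q) (S.xcvReal i) phat ∧
    ∀ ξhat, S.IsOptimal i phat ξhat →
    ∀ (r : ℕ) (M : Matrix (Fin np) (Fin r) ℝ),
    ∃ φ : Fin (r + 1) → (Fin np → ℝ) → ℝ,
      -- the homogenization sequence is well defined, and given by the linear programs
      IsHomogSeq (S.xcvReal i) phat M φ ∧
      (∀ (j : Fin (r + 1)) (d : Fin np → ℝ),
        IsGreatest ((fun v => (S.matG ξhat phat *ᵥ d) ⬝ᵥ v) '' S.lpFeasible ξhat phat i M φ j)
          (φ j d)) ∧
      -- the optimal solution sets are nested argmax sets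
      (∀ j j' : Fin r, (j : ℕ) = j' + 1 →
        S.lpOptSet ξhat phat i M φ j =
            argmaxOn (S.lpOptSet ξhat phat i M φ j')
              (fun v => (S.matG ξhat phat *ᵥ M.col j) ⬝ᵥ v) ∧
          S.lpOptSet ξhat phat i M φ j ⊆ S.lpOptSet ξhat phat i M φ j') ∧
      -- the LD-derivative
      (∀ j : Fin r, (j : ℕ) + 1 = r → ∀ v ∈ S.lpOptSet ξhat phat i M φ j,
        IsLDDerivative (S.xcvReal i) phat M (v ᵥ* (S.matG ξhat phat * M))) ∧
      -- the L-derivative and subgradient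
      (Submodule.span ℝ (Set.range M.col) = ⊤ →
        ∃ J : Fin np → ℝ,
          IsLDerivative (S.xcvReal i) phat M J ∧
          IsSubgradient S.P (S.xcv i) phat J ∧
          (∀ L, IsLDDerivative (S.xcvReal i) phat M L → ∀ J', J' ᵥ* M = L ↔ J' = J) ∧
          ∀ j : Fin r, (j : ℕ) + 1 = r → ∀ v ∈ S.lpOptSet ξhat phat i M φ j,
            J = v ᵥ* S.matG ξhat phat) := by
  classical
  have hQ := ImplicitSystem.mem_Q_of_isSlater hSl
  have hcomp : ∀ ξ, S.IsOptimal i phat ξ →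
      IsCompact (dualMultipliers (S.matA ξ phat) (S.matB ξ phat) i) ∧
      (dualMultipliers (S.matA ξ phat) (S.matB ξ phat) i).Nonempty := fun ξ hξ => by
    obtain ⟨σ, hσ, hσB⟩ := ImplicitSystem.exists_slater_direction hR hSl hξ.1
    exact ⟨isCompact_dualMultipliers (ImplicitSystem.linearIndependent_matB hSl ξ phat) hσ hσB i,
      ImplicitSystem.nonempty_dualMultipliers hR hSl hξ⟩
  have hdir : ∀ ξ, S.IsOptimal i phat ξ → ∀ d, HasDirDeriv (S.xcvReal i) phat d
      (sSup ((fun v => (S.matG ξ phat *ᵥ d) ⬝ᵥ v) ''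
        dualMultipliers (S.matA ξ phat) (S.matB ξ phat) i)) := fun ξ hξ d =>
    ImplicitSystem.hasDirDeriv_xcvReal hS hR hSl hξ
      (isGreatest_sSup_linear (hcomp ξ hξ).1 (hcomp ξ hξ).2 d)
  refine ⟨fun p hp => ?_, ?_, ?_⟩
  · obtain ⟨ξ, hξ⟩ := ImplicitSystem.exists_isOptimal hS hR hp i
    exact ⟨ξ, hξ, hξ.xcv_eq hR hp.1⟩
  · obtain ⟨ξ, hξ⟩ := ImplicitSystem.exists_isOptimal hS hR hQ i
    exact ⟨isOpen_interior, hSl.mem_interior, ImplicitSystem.locallyLipschitzOn_xcvReal hS hR i,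
      fun d => ⟨_, hdir ξ hξ d⟩, fun r M =>
      ⟨_, isHomogSeq_iteratedArgmax (hcomp ξ hξ).1 (hcomp ξ hξ).2 (hdir ξ hξ) M⟩⟩
  intro ξ hξ r M
  obtain ⟨hC, hne⟩ := hcomp ξ hξ
  set C := dualMultipliers (S.matA ξ phat) (S.matB ξ phat) i with hCdef
  set G := S.matG ξ phat with hG
  set φ : Fin (r + 1) → (Fin np → ℝ) → ℝ :=
    fun j d => sSup ((fun v => (G *ᵥ d) ⬝ᵥ v) '' iteratedArgmax G M C j) with hφ
  have hseq : IsHomogSeq (S.xcvReal i) phat M φ :=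
    isHomogSeq_iteratedArgmax hC hne (hdir ξ hξ) M
  have hfeas : ∀ j, S.lpFeasible ξ phat i M φ j = iteratedArgmax G M C j :=
    fun j => dualFeasible_eq_iteratedArgmax hC hne M j
  -- Index shift: stage `0` is `C` itself, so the optimal set for column `j` is stage `j + 1`.
  have hopt : ∀ j : Fin r, S.lpOptSet ξ phat i M φ j = iteratedArgmax G M C j.succ := fun j => by
    rw [iteratedArgmax_succ, ← hfeas]
    rfl
  have hval : ∀ v ∈ iteratedArgmax G M C (Fin.last r), ∀ k : Fin r,
      (v ᵥ* (G * M)) k = φ k.castSucc (M.col k) := fun v hv k => by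
    rw [vecMul_mul_apply]
    exact dotProduct_eq_of_mem_iteratedArgmax hC hne M hv k (Fin.castSucc_lt_last k)
  have hlast : ∀ j : Fin r, (j : ℕ) + 1 = r → j.succ = Fin.last r := fun j hj =>
    Fin.ext (by simpa using hj)
  refine ⟨φ, hseq, fun j d => ?_, fun j j' hj => ?_, fun j hj v hv => ?_, fun hM => ?_⟩
  · rw [hfeas]
    exact isGreatest_sSup_linear (isCompact_iteratedArgmax hC M j)
      (nonempty_iteratedArgmax hC hne M j) d
  · have hjj : j.castSucc = j'.succ := Fin.ext (by simpa using hj)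
    have heq : S.lpOptSet ξ phat i M φ j =
        argmaxOn (S.lpOptSet ξ phat i M φ j') fun v => (G *ᵥ M.col j) ⬝ᵥ v := by
      rw [hopt, hopt, iteratedArgmax_succ, hjj]
    exact ⟨heq, heq ▸ fun v hv => hv.1⟩
  · rw [hopt, hlast j hj] at hv
    exact ⟨φ, hseq, hval v hv⟩
  -- Taking `v` from the last stage also covers `r = 0`, where that stage is `C`.
  · obtain ⟨v, hv⟩ := nonempty_iteratedArgmax (G := G) hC hne M (Fin.last r)
    have hvC : v ∈ C := ((mem_iteratedArgmax_iff hC hne M _ v).mp hv).1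
    have huniq : ∀ w ∈ iteratedArgmax G M C (Fin.last r), w ᵥ* G = v ᵥ* G := fun w hw => by
      rw [← vecMul_eq_vecMul_iff_of_span hM, vecMul_vecMul, vecMul_vecMul]
      ext k
      rw [hval v hv, hval w hw]
    have hφlast : φ (Fin.last r) = fun d => (v ᵥ* G) ⬝ᵥ d := by
      funext d
      obtain ⟨w, hw, hwd⟩ := (isGreatest_sSup_linear (G := G)
        (isCompact_iteratedArgmax (G := G) hC M (Fin.last r))
        (nonempty_iteratedArgmax hC hne M (Fin.last r)) d).1
      rw [hφ]
      simp only at hwd ⊢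
      rw [← hwd, ← huniq w hw, dotProduct_comm, dotProduct_mulVec]
    refine ⟨v ᵥ* G, ⟨hM, φ, hseq, ?_⟩, ⟨hQ.1, ?_, ?_, fun p hp => ?_⟩, fun L hL J' => ?_,
      fun j hj w hw => ?_⟩
    · have he : φ (Fin.last r) = (∑ m, (v ᵥ* G) m •
          (ContinuousLinearMap.proj m : (Fin np → ℝ) →L[ℝ] ℝ) : (Fin np → ℝ) →L[ℝ] ℝ) := by
        rw [hφlast]
        ext d
        simp [dotProduct]
      rw [he]
      exact ContinuousLinearMap.hasFDerivAt _
    · rw [hξ.xcv_eq hR hQ.1]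
      exact EReal.coe_ne_top _
    · rw [hξ.xcv_eq hR hQ.1]
      exact EReal.coe_ne_bot _
    · rw [hξ.xcv_eq hR hQ.1, ImplicitSystem.xcv_eq_iInf_Ω hR hp, ← EReal.coe_add]
      -- For `p` outside `Q` the feasible set may be empty; the infimum is then `⊤` and nothing is
      -- to be checked.
      refine le_iInf₂ fun η hη => EReal.coe_le_coe_iff.mpr ?_
      have h := ImplicitSystem.add_dual_le_of_mem_Ω hR hξ.1 hη hvC
      rwa [dotProduct_comm, dotProduct_mulVec] at h
    · obtain ⟨ψ, hψ, hL⟩ := hL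
      obtain rfl := hψ.unique hseq
      have hLv : L = (v ᵥ* G) ᵥ* M := by
        ext k
        rw [hL, vecMul_vecMul, hval v hv]
      rw [hLv, vecMul_eq_vecMul_iff_of_span hM]
    · rw [hopt, hlast j hj] at hw
      exact (huniq w hw).symm
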